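/- Let $\pi_1\ge\pi_2\ge\cdots\ge 0$ with $\sum_{k\ge1}\pi_k=1$, and let $R(0),R(1),\dots$ be i.i.d. with $\Pr[R(t)=k]=\pi_k$. An infinite list starts at time $0$ in the order $1,2,3,\dots$; at each time $t=0,1,2,\dots$ item $R(t)$ is requested and exchanges places with the item directly in front of it (nothing happens if it is first). Let $X_j(t)$ be the position of item $j$ at time $t$. For $n\ge1$ and $0\le\beta<1$ consider the constrained asymmetric exclusion process of $n$ particles on the slots $1,2,3,\dots$: each particle attempts jumps at rate $1$, to the left with probability $p=\frac{1}{1+\beta}$ and to the right with probability $q=\frac{\beta}{1+\beta}$ (so $q/p=\beta$), and an attempt succeeds only if the target is an existing empty slot. Let $Z_1<\dots<Z_n$ be the particle positions under a stationary distribution of this process (one exists), and let $\kappa_n(\beta):=Z_n-n\ge0$ be the stationary deviation of the last particle from its minimal position. For $\beta=1$, when there is no stationary distribution, put $\kappa_n(1):=\infty$. Then for all integers $x\ge i\ge1$ with $\pi_i>0$, with $\beta:=\pi_{i+1}/\pi_i\le1$, \[ \limsup_{t\to\infty}\Pr\Big[\max_{1\le j\le i}X_j(t)>x\Big]\le\Pr\big[\kappa_i(\beta)+i>x\big].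 \] -/

import Mathlib

open Filter MeasureTheory ProbabilityTheory
open scoped NNReal ENNReal

/-- Every set of items is measurable. -/
instance PNat.instMeasurableSpaceTop : MeasurableSpace ℕ+ := ⊤

/-! ### The transposition rule -/

/-- One step of the transposition rule. The list is encoded by `σ`, where `σ j` is the position of
item `j`. When item `r` is requested it exchanges places with the item directly in front of it;
nothing happens when `r` is already first. -/
def transposeStep (σ : Equiv.Perm ℕ+) (r : ℕ+) : Equiv.Perm ℕ+ :=
  if σ r = 1 then σ else σ.trans (Equiv.swap (σ r) (σ r - 1))

/-- `listPos r t j` is the position at time `t` of item `j`, when the list starts in the order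
`1, 2, 3, …` and item `r s` is requested at each time `s = 0, 1, 2, …`. -/
def listPos (r : ℕ → ℕ+) : ℕ → Equiv.Perm ℕ+
  | 0 => Equiv.refl ℕ+
  | t + 1 => transposeStep (listPos r t) (r t)

/-! ### The constrained asymmetric exclusion process -/

/-- Configurations of `n` particles on the slots `1, 2, 3, …`: the positions of the particles,
enumerated from left to right, with at most one particle per slot. -/
abbrev ParticleConfig (n : ℕ+) : Type := {z : Fin n → ℕ+ // StrictMono z}

/-- `w` arises from `z` by moving particle `j` one slot to the right. As `w` is a configuration,
this is possible only if the target slot is empty in `z`. Conversely, `z` then arises from `w` by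
moving particle `j` one slot to the left. -/
def MovesRight {n : ℕ+} (j : Fin n) (z w : ParticleConfig n) : Prop :=
  w.1 = Function.update z.1 j (z.1 j + 1)

open Classical in
/-- Jump rate from `z` to `w`: every particle attempts jumps at rate `1`, to the left with
probability `p` and to the right with probability `q`; attempts to enter an occupied slot or to
leave the half-line have no effect. -/
noncomputable def jumpRate {n : ℕ+} (p q : ℝ≥0) (z w : ParticleConfig n) : ℝ≥0∞ :=
  ∑ j : Fin n, ((if MovesRight j w z then (p : ℝ≥0∞) else 0) +
    (if MovesRight j z w then (q : ℝ≥0∞) else 0))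

/-- `μ` is a stationary distribution of the `n`-particle process with `p + q = 1` and `q / p = β`:
in every configuration the probability flow out equals the probability flow in. (The total jump
rates are at most `n`, so this is the stationarity of the continuous-time Markov chain.) -/
def IsStationaryLaw (n : ℕ+) (β : ℝ≥0) (μ : PMF (ParticleConfig n)) : Prop :=
  ∀ w : ParticleConfig n,
    μ w * ∑' z, jumpRate (1 / (1 + β)) (β / (1 + β)) w z =
      ∑' z, μ z * jumpRate (1 / (1 + β)) (β / (1 + β)) z w

/-- The position of the last (`n`-th) particle. -/
def lastPos {n : ℕ+} (z : ParticleConfig n) : ℕ :=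
  z.1 ⟨n - 1, Nat.sub_lt n.pos one_pos⟩

/-- `κ` is the law of the stationary deviation of the last of `n` particles from its minimal
position `n`. If there is no stationary distribution (as for `β = 1`), the deviation is
infinite. -/
def IsDeviationLaw (n : ℕ+) (β : ℝ≥0) (κ : PMF ℕ∞) : Prop :=
  (∃ μ : PMF (ParticleConfig n), IsStationaryLaw n β μ ∧
    κ = μ.map fun z => ((lastPos z - n : ℕ) : ℕ∞)) ∨
  ((¬ ∃ μ : PMF (ParticleConfig n), IsStationaryLaw n β μ) ∧ κ = PMF.pure ⊤)

/-! Only the set of positions of the items `1, …, i` matters; regard these positions as particles.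
Requesting an item `r ≤ i` is an attempt of its particle to jump left, of probability `π r ≥ π i`.
Requesting the item directly behind a particle, if it is some `r > i`, moves that particle right,
with probability `π r ≤ π (i + 1)`. All other requests leave the set alone. So on increasing
functions one request is bounded by the identity plus the generator of the exclusion process with
rates `π i` and `π (i + 1)` (`requestStep_itemConfig_le`).

This bound cannot simply be iterated: the total rate `i * (π i + π (i + 1))` may exceed `1`, and
then a full step need not preserve monotonicity. A step slowed down by a small `δ` does, because the
jump attempts are monotone maps. Hence the lazy list is dominated by the lazy exclusion process
(`iterate_lazyRequest_itemConfig_le`). Started from the packed configuration, the latter stays below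
its stationary expectation `c` (`iterate_lazyStep_packed_le`); started elsewhere, the excess is at
most `s ^ j * Φ`, with `s < 1` and a Lyapunov function `Φ` (`iterate_lazyStep_le`).

It remains to remove the laziness (`exists_iterate_requestStep_le`). Let `T` be the request operator
and `L = (1 - δ) + δ T`. By induction on `m`, for all `j` at once, `T^m L^j G ≤ c + s ^ j * ρ ^ m *
M * (A + Φ)`. Off the packed configuration this follows from the decay of `Φ`. At the packed
configuration the front item is one of the first `i`; with probability at least `π i` it is
requested and nothing changes. Staying put twice in a row preserves part of the improvement
contained in the bound for `j + 1`. The case `j = 0` is geometric convergence to below `c`. -/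

namespace ParticleConfig

variable {n : ℕ+}

/-! ### Jump attempts and their monotonicity -/

open Classical in
/-- The attempt of particle `k` to jump to the left; a blocked attempt has no effect. -/
noncomputable def jumpLeft (k : Fin n) (z : ParticleConfig n) : ParticleConfig n :=
  if h : StrictMono (Function.update z.1 k (z.1 k - 1)) ∧ z.1 k ≠ 1 then ⟨_, h.1⟩ else z

open Classical in
/-- The attempt of particle `k` to jump to the right; a blocked attempt has no effect. -/
noncomputable def jumpRight (k : Fin n) (z : ParticleConfig n) : ParticleConfig n :=
  if h : StrictMono (Function.update z.1 k (z.1 k + 1)) then ⟨_, h⟩ else z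

theorem lt_of_lt (z : ParticleConfig n) {j k : Fin n} (h : j < k) : (z.1 j : ℕ) < z.1 k :=
  PNat.coe_lt_coe _ _ |>.2 (z.2 h)

theorem coe_sub_one {a : ℕ+} (h : a ≠ 1) : ((a - 1 : ℕ+) : ℕ) = a - 1 := by
  rw [PNat.sub_coe, if_pos (lt_of_le_of_ne (one_le) (Ne.symm h))]; rfl

theorem strictMono_update_left {z : ParticleConfig n} {k : Fin n} (h1 : z.1 k ≠ 1) :
    StrictMono (Function.update z.1 k (z.1 k - 1)) ↔ z.1 k - 1 ∉ Set.range z.1 := by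
  have hc := coe_sub_one h1
  have h1' : (z.1 k : ℕ) ≠ 1 := by simpa using h1
  constructor
  · rintro h ⟨l, hl⟩
    have hl' : (z.1 l : ℕ) = z.1 k - 1 := by rw [hl, hc]
    have hk := (z.1 k).pos
    rcases lt_trichotomy l k with hlk | rfl | hlk
    · have := h hlk
      rw [Function.update_of_ne hlk.ne, Function.update_self, hl] at this
      exact lt_irrefl _ this
    · omega
    · have := z.lt_of_lt hlk
      omega
  · intro h a b hab
    have key := z.lt_of_lt hab
    rw [← PNat.coe_lt_coe]
    by_cases ha : a = k
    · subst ha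
      rw [Function.update_self, Function.update_of_ne hab.ne', hc]; omega
    · by_cases hb : b = k
      · subst hb
        rw [Function.update_self, Function.update_of_ne hab.ne, hc]
        have : (z.1 a : ℕ) ≠ z.1 b - 1 := fun e => h ⟨a, PNat.eq (by rw [hc]; exact e)⟩
        omega
      · rwa [Function.update_of_ne ha, Function.update_of_ne hb]

theorem strictMono_update_right {z : ParticleConfig n} {k : Fin n} :
    StrictMono (Function.update z.1 k (z.1 k + 1)) ↔ z.1 k + 1 ∉ Set.range z.1 := by
  constructor
  · rintro h ⟨l, hl⟩
    have hl' : (z.1 l : ℕ) = z.1 k + 1 := by rw [hl, PNat.add_coe]; rfl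
    rcases lt_trichotomy l k with hlk | rfl | hlk
    · have := z.lt_of_lt hlk
      omega
    · omega
    · have := h hlk
      rw [Function.update_of_ne hlk.ne', Function.update_self, hl] at this
      exact lt_irrefl _ this
  · intro h a b hab
    have key := z.lt_of_lt hab
    rw [← PNat.coe_lt_coe]
    by_cases ha : a = k
    · subst ha
      rw [Function.update_self, Function.update_of_ne hab.ne', PNat.add_coe, PNat.one_coe]
      have : (z.1 b : ℕ) ≠ z.1 a + 1 := fun e =>
        h ⟨b, PNat.eq (by rw [PNat.add_coe, PNat.one_coe]; exact e)⟩
      omega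
    · by_cases hb : b = k
      · subst hb
        rw [Function.update_self, Function.update_of_ne hab.ne, PNat.add_coe, PNat.one_coe]
        omega
      · rwa [Function.update_of_ne ha, Function.update_of_ne hb]

/-- Either the left jump of particle `k` is blocked, by the wall or by another particle, or it
takes place. -/
theorem jumpLeft_cases (k : Fin n) (z : ParticleConfig n) :
    (jumpLeft k z = z ∧ ((z.1 k : ℕ) = 1 ∨ ∃ l < k, (z.1 l : ℕ) + 1 = z.1 k)) ∨
    ((jumpLeft k z).1 = Function.update z.1 k (z.1 k - 1) ∧ z.1 k ≠ 1 ∧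
      z.1 k - 1 ∉ Set.range z.1 ∧ ((jumpLeft k z).1 k : ℕ) + 1 = z.1 k) := by
  by_cases h1 : z.1 k = 1
  · left
    refine ⟨dif_neg (fun h => h.2 h1), Or.inl (by simp [h1])⟩
  have hc := coe_sub_one h1
  have h1' : (z.1 k : ℕ) ≠ 1 := by simpa using h1
  have hpos := (z.1 k).pos
  by_cases h : StrictMono (Function.update z.1 k (z.1 k - 1))
  · right
    have e : (jumpLeft k z).1 = Function.update z.1 k (z.1 k - 1) := by
      rw [jumpLeft, dif_pos ⟨h, h1⟩]
    refine ⟨e, h1, (strictMono_update_left h1).1 h, ?_⟩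
    rw [e, Function.update_self, hc]; omega
  · left
    refine ⟨dif_neg (fun h' => h h'.1), Or.inr ?_⟩
    rw [strictMono_update_left h1, not_not] at h
    obtain ⟨l, hl⟩ := h
    have hl' : (z.1 l : ℕ) = z.1 k - 1 := by rw [hl, hc]
    refine ⟨l, ?_, by omega⟩
    by_contra hlk
    rcases (not_lt.1 hlk).lt_or_eq with h2 | h2
    · have := z.lt_of_lt h2; omega
    · subst h2; omega

/-- Either the right jump of particle `k` is blocked by another particle, or it takes place. -/
theorem jumpRight_cases (k : Fin n) (z : ParticleConfig n) :
    (jumpRight k z = z ∧ ∃ l > k, (z.1 l : ℕ) = z.1 k + 1) ∨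
    ((jumpRight k z).1 = Function.update z.1 k (z.1 k + 1) ∧
      z.1 k + 1 ∉ Set.range z.1 ∧ ((jumpRight k z).1 k : ℕ) = z.1 k + 1) := by
  by_cases h : StrictMono (Function.update z.1 k (z.1 k + 1))
  · right
    have e : (jumpRight k z).1 = Function.update z.1 k (z.1 k + 1) := by
      rw [jumpRight, dif_pos h]
    refine ⟨e, strictMono_update_right.1 h, ?_⟩
    rw [e, Function.update_self]; simp
  · left
    refine ⟨dif_neg h, ?_⟩
    rw [strictMono_update_right, not_not] at h
    obtain ⟨l, hl⟩ := h
    have hl' : (z.1 l : ℕ) = z.1 k + 1 := by rw [hl]; simp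
    refine ⟨l, ?_, hl'⟩
    by_contra hlk
    rcases (not_lt.1 hlk).lt_or_eq with h2 | h2
    · have := z.lt_of_lt h2; omega
    · subst h2; omega

theorem jumpLeft_of_ne {j k : Fin n} (h : j ≠ k) (z : ParticleConfig n) :
    (jumpLeft k z).1 j = z.1 j := by
  rcases jumpLeft_cases k z with ⟨e, -⟩ | ⟨e, -⟩
  · rw [e]
  · rw [e, Function.update_of_ne h]

theorem jumpRight_of_ne {j k : Fin n} (h : j ≠ k) (z : ParticleConfig n) :
    (jumpRight k z).1 j = z.1 j := by
  rcases jumpRight_cases k z with ⟨e, -⟩ | ⟨e, -⟩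
  · rw [e]
  · rw [e, Function.update_of_ne h]

theorem jumpLeft_le (k : Fin n) (z : ParticleConfig n) : jumpLeft k z ≤ z := by
  intro j
  by_cases h : j = k
  · subst h
    rcases jumpLeft_cases j z with ⟨e, -⟩ | ⟨-, -, -, e⟩
    · rw [e]
    · exact (PNat.coe_le_coe _ _).1 (by omega)
  · exact (jumpLeft_of_ne h z).le

theorem le_jumpRight (k : Fin n) (z : ParticleConfig n) : z ≤ jumpRight k z := by
  intro j
  by_cases h : j = k
  · subst h
    rcases jumpRight_cases j z with ⟨e, -⟩ | ⟨-, -, e⟩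
    · rw [e]
    · exact (PNat.coe_le_coe _ _).1 (by omega)
  · exact (jumpRight_of_ne h z).ge

/-- Order can only fail if both configurations have particle `k` in the same slot and only the
larger one moves. But a particle blocking the smaller configuration pushes its counterpart in the
larger one into the same target slot. -/
theorem jumpLeft_mono (k : Fin n) : Monotone (jumpLeft (n := n) k) := by
  intro z w hzw j
  have hz : ∀ l, (z.1 l : ℕ) ≤ w.1 l := fun l => (PNat.coe_le_coe _ _).2 (hzw l)
  by_cases h : j = k
  · subst h
    refine (PNat.coe_le_coe _ _).1 ?_
    have hj := hz j
    rcases jumpLeft_cases j w with ⟨e, -⟩ | ⟨-, h1, h2, e⟩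
    · rw [e]
      exact ((PNat.coe_le_coe _ _).2 (jumpLeft_le j z j)).trans hj
    · rcases jumpLeft_cases j z with ⟨e', h3⟩ | ⟨-, -, -, e'⟩
      · rw [e']
        have h1' : (w.1 j : ℕ) ≠ 1 := by simpa using h1
        have := (w.1 j).pos
        rcases h3 with h3 | ⟨l, hl, h3⟩
        · omega
        · have hl1 := w.lt_of_lt hl
          have hl2 := hz l
          have : (w.1 l : ℕ) ≠ w.1 j - 1 := fun e2 =>
            h2 ⟨l, PNat.eq (by rw [coe_sub_one h1]; exact e2)⟩
          omega
      · omega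
  · change (jumpLeft k z).1 j ≤ (jumpLeft k w).1 j
    rw [jumpLeft_of_ne h, jumpLeft_of_ne h]
    exact hzw j

theorem jumpRight_mono (k : Fin n) : Monotone (jumpRight (n := n) k) := by
  intro z w hzw j
  have hz : ∀ l, (z.1 l : ℕ) ≤ w.1 l := fun l => (PNat.coe_le_coe _ _).2 (hzw l)
  by_cases h : j = k
  · subst h
    refine (PNat.coe_le_coe _ _).1 ?_
    have hj := hz j
    rcases jumpRight_cases j z with ⟨e, -⟩ | ⟨-, h2, e⟩
    · rw [e]
      exact hj.trans ((PNat.coe_le_coe _ _).2 (le_jumpRight j w j))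
    · rcases jumpRight_cases j w with ⟨e', l, hl, h3⟩ | ⟨-, -, e'⟩
      · rw [e']
        have hl1 := z.lt_of_lt hl
        have hl2 := hz l
        have : (z.1 l : ℕ) ≠ z.1 j + 1 := fun e2 =>
          h2 ⟨l, PNat.eq (by rw [PNat.add_coe, PNat.one_coe]; exact e2)⟩
        omega
      · omega
  · change (jumpRight k z).1 j ≤ (jumpRight k w).1 j
    rw [jumpRight_of_ne h, jumpRight_of_ne h]
    exact hzw j

theorem range_update_eq_swap (f : Fin n → ℕ+) (hf : Function.Injective f) (k : Fin n) (b : ℕ+)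
    (hb : b ∉ Set.range f) :
    Set.range (Function.update f k b) = Equiv.swap (f k) b '' Set.range f := by
  rw [← Set.range_comp]
  congr 1
  ext1 j
  by_cases h : j = k
  · subst h; simp
  · rw [Function.update_of_ne h, Function.comp_apply, Equiv.swap_apply_of_ne_of_ne]
    · exact fun e => h (hf e)
    · rintro rfl; exact hb ⟨j, rfl⟩

theorem swap_image_of_mem {s : Set ℕ+} {a b : ℕ+} (h : a ∈ s ↔ b ∈ s) :
    Equiv.swap a b '' s = s := by
  ext c
  rw [Equiv.image_eq_preimage_symm, Set.mem_preimage, Equiv.symm_swap]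
  by_cases hca : c = a
  · subst hca; rw [Equiv.swap_apply_left]; exact h.symm
  by_cases hcb : c = b
  · subst hcb; rw [Equiv.swap_apply_right]; exact h
  rw [Equiv.swap_apply_of_ne_of_ne hca hcb]

/-- On occupied sets an attempt is a transposition of neighbouring slots, blocked or not, since a
transposition fixes a set containing both slots. This is the link with the transposition rule. -/
theorem range_jumpLeft {k : Fin n} {z : ParticleConfig n} (h : z.1 k ≠ 1) :
    Set.range (jumpLeft k z).1 = Equiv.swap (z.1 k) (z.1 k - 1) '' Set.range z.1 := by
  rcases jumpLeft_cases k z with ⟨e, h1⟩ | ⟨e, -, h2, -⟩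
  · rw [e, swap_image_of_mem]
    refine iff_of_true ⟨k, rfl⟩ ?_
    rcases h1 with h1 | ⟨l, -, hl⟩
    · exact absurd (PNat.eq (by simpa using h1)) h
    · exact ⟨l, PNat.eq (by rw [coe_sub_one h]; omega)⟩
  · rw [e, range_update_eq_swap _ z.2.injective _ _ h2]

theorem range_jumpRight (k : Fin n) (z : ParticleConfig n) :
    Set.range (jumpRight k z).1 = Equiv.swap (z.1 k) (z.1 k + 1) '' Set.range z.1 := by
  rcases jumpRight_cases k z with ⟨e, l, -, hl⟩ | ⟨e, h2, -⟩
  · rw [e, swap_image_of_mem]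
    exact iff_of_true ⟨k, rfl⟩ ⟨l, PNat.eq (by rw [hl]; simp)⟩
  · rw [e, range_update_eq_swap _ z.2.injective _ _ h2]

theorem eq_of_range_eq {z w : ParticleConfig n} (h : Set.range z.1 = Set.range w.1) : z = w :=
  Subtype.ext ((StrictMono.range_inj z.2 w.2).1 h)

theorem movesRight_iff_jumpRight {j : Fin n} {z w : ParticleConfig n} :
    MovesRight j z w ↔ jumpRight j z = w ∧ jumpRight j z ≠ z := by
  unfold MovesRight
  constructor
  · intro h
    have hs : StrictMono (Function.update z.1 j (z.1 j + 1)) := h ▸ w.2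
    have e : jumpRight j z = w := by
      rw [jumpRight, dif_pos hs]; exact Subtype.ext h.symm
    refine ⟨e, fun e' => ?_⟩
    have h3 := congrFun h j
    rw [← e, e', Function.update_self] at h3
    have := congrArg PNat.val h3
    simp at this
  · rintro ⟨rfl, h⟩
    rcases jumpRight_cases j z with ⟨e, -⟩ | ⟨e, -⟩
    · exact absurd e h
    · exact e

theorem movesRight_iff_jumpLeft {j : Fin n} {z w : ParticleConfig n} :
    MovesRight j w z ↔ jumpLeft j z = w ∧ jumpLeft j z ≠ z := by
  unfold MovesRight
  constructor
  · intro h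
    have hj : z.1 j = w.1 j + 1 := by rw [h, Function.update_self]
    have hj' : (z.1 j : ℕ) = w.1 j + 1 := by rw [hj]; simp
    have h1 : z.1 j ≠ 1 := by
      intro e
      have := (w.1 j).pos
      rw [e, PNat.one_coe] at hj'
      omega
    have hup : Function.update z.1 j (z.1 j - 1) = w.1 := by
      funext l
      by_cases hl : l = j
      · subst hl
        refine PNat.eq ?_
        rw [Function.update_self, coe_sub_one h1]; omega
      · rw [Function.update_of_ne hl, h, Function.update_of_ne hl]
    have hs : StrictMono (Function.update z.1 j (z.1 j - 1)) := hup ▸ w.2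
    have e : jumpLeft j z = w := by
      rw [jumpLeft, dif_pos ⟨hs, h1⟩]; exact Subtype.ext hup
    refine ⟨e, fun e' => ?_⟩
    rw [e] at e'
    rw [e'] at hj'
    omega
  · rintro ⟨rfl, h⟩
    rcases jumpLeft_cases j z with ⟨e, -⟩ | ⟨e, h1, -, h3⟩
    · exact absurd e h
    · have : (jumpLeft j z).1 j + 1 = z.1 j := PNat.eq (by simpa using h3)
      rw [this, e]
      simp

/-- The configuration with particles on the slots `1, …, n`. -/
def packed (n : ℕ+) : ParticleConfig n :=
  ⟨fun k => Nat.succPNat k, fun _ _ h => Nat.succPNat_lt_succPNat.2 h⟩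

theorem packed_le (z : ParticleConfig n) : packed n ≤ z := by
  intro k
  rw [← PNat.coe_le_coe]
  change (k : ℕ) + 1 ≤ z.1 k
  obtain ⟨k, hk⟩ := k
  induction k with
  | zero => exact (z.1 _).pos
  | succ m ih =>
    have h1 := ih (Nat.lt_of_succ_lt hk)
    have h2 := z.lt_of_lt (show (⟨m, Nat.lt_of_succ_lt hk⟩ : Fin n) < ⟨m + 1, hk⟩ from
      Nat.lt_succ_self m)
    simp only at h1 ⊢
    omega

theorem eq_packed_of_jumpLeft {z : ParticleConfig n} (h : ∀ k, jumpLeft k z = z) :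
    z = packed n := by
  refine Subtype.ext (funext fun k => PNat.eq ?_)
  change (z.1 k : ℕ) = k + 1
  obtain ⟨k, hk⟩ := k
  induction k using Nat.strong_induction_on with
  | _ k ih =>
    rcases jumpLeft_cases ⟨k, hk⟩ z with ⟨-, h1⟩ | ⟨-, -, -, h3⟩
    · have hp := (PNat.coe_le_coe _ _).2 (packed_le z ⟨k, hk⟩)
      change k + 1 ≤ (z.1 ⟨k, hk⟩ : ℕ) at hp
      rcases h1 with h1 | ⟨⟨l, hl⟩, hlk, h1⟩
      · simp only at h1 ⊢; omega
      · have := ih l hlk hl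
        have hlk' : l < k := hlk
        simp only at this h1 hp ⊢
        omega
    · rw [h] at h3; omega

/-! ### The generator and its slowed-down step -/

/-- The generator of the exclusion process with jump rates `p` to the left and `q` to the right. -/
noncomputable def drift (p q : ℝ) (f : ParticleConfig n → ℝ) (z : ParticleConfig n) : ℝ :=
  ∑ k, (p * (f (jumpLeft k z) - f z) + q * (f (jumpRight k z) - f z))

/-- One step of the discrete-time exclusion process that is obtained from `drift` with step
size `δ`. -/
noncomputable def lazyStep (δ p q : ℝ) (f : ParticleConfig n → ℝ) (z : ParticleConfig n) : ℝ :=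
  f z + δ * drift p q f z

theorem drift_add (p q : ℝ) (f g : ParticleConfig n → ℝ) (z : ParticleConfig n) :
    drift p q (fun z => f z + g z) z = drift p q f z + drift p q g z := by
  unfold drift
  rw [← Finset.sum_add_distrib]
  exact Finset.sum_congr rfl fun _ _ => by ring

theorem drift_const_add (p q a : ℝ) (f : ParticleConfig n → ℝ) (z : ParticleConfig n) :
    drift p q (fun z => a + f z) z = drift p q f z := by
  unfold drift
  exact Finset.sum_congr rfl fun _ _ => by ring

theorem drift_const_mul (p q a : ℝ) (f : ParticleConfig n → ℝ) (z : ParticleConfig n) :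
    drift p q (fun z => a * f z) z = a * drift p q f z := by
  unfold drift
  rw [Finset.mul_sum]
  exact Finset.sum_congr rfl fun _ _ => by ring

/-- For `δ * (n * (p + q)) ≤ 1` and nonnegative rates all coefficients are nonnegative; positivity
and preservation of monotonicity follow from this form. -/
theorem lazyStep_eq (δ p q : ℝ) (f : ParticleConfig n → ℝ) (z : ParticleConfig n) :
    lazyStep δ p q f z = (1 - δ * (n * (p + q))) * f z +
      δ * ∑ k, (p * f (jumpLeft k z) + q * f (jumpRight k z)) := by
  have : drift p q f z = ∑ k, (p * f (jumpLeft k z) + q * f (jumpRight k z)) -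
      n * (p + q) * f z := by
    have h : (n : ℝ) * (p + q) * f z = ∑ _k : Fin n, (p + q) * f z := by
      rw [Finset.sum_const, Finset.card_univ, Fintype.card_fin, nsmul_eq_mul, mul_assoc]
    rw [h, ← Finset.sum_sub_distrib]
    exact Finset.sum_congr rfl fun _ _ => by ring
  rw [lazyStep, this]
  ring

theorem lazyStep_le_lazyStep {δ p q : ℝ} (hδ : 0 ≤ δ) (hp : 0 ≤ p) (hq : 0 ≤ q)
    (h : δ * (n * (p + q)) ≤ 1) {f g : ParticleConfig n → ℝ} (hfg : ∀ z, f z ≤ g z)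
    (z : ParticleConfig n) : lazyStep δ p q f z ≤ lazyStep δ p q g z := by
  rw [lazyStep_eq, lazyStep_eq]
  have : 0 ≤ 1 - δ * (n * (p + q)) := by linarith
  gcongr <;> apply hfg

theorem lazyStep_monotone {δ p q : ℝ} (hδ : 0 ≤ δ) (hp : 0 ≤ p) (hq : 0 ≤ q)
    (h : δ * (n * (p + q)) ≤ 1) {f : ParticleConfig n → ℝ} (hf : Monotone f) :
    Monotone (lazyStep δ p q f) := by
  intro z w hzw
  rw [lazyStep_eq, lazyStep_eq]
  have : 0 ≤ 1 - δ * (n * (p + q)) := by linarith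
  gcongr with k
  · exact hf hzw
  · exact hf (jumpLeft_mono k hzw)
  · exact hf (jumpRight_mono k hzw)

theorem lazyStep_const_add (δ p q a : ℝ) (f : ParticleConfig n → ℝ) (z : ParticleConfig n) :
    lazyStep δ p q (fun z => a + f z) z = a + lazyStep δ p q f z := by
  rw [lazyStep, lazyStep, drift_const_add]; ring

theorem lazyStep_const_mul (δ p q a : ℝ) (f : ParticleConfig n → ℝ) (z : ParticleConfig n) :
    lazyStep δ p q (fun z => a * f z) z = a * lazyStep δ p q f z := by
  rw [lazyStep, lazyStep, drift_const_mul]; ring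

theorem lazyStep_const (δ p q a : ℝ) (z : ParticleConfig n) :
    lazyStep δ p q (fun _ => a) z = a := by
  simp [lazyStep, drift]

theorem iterate_lazyStep_monotone {δ p q : ℝ} (hδ : 0 ≤ δ) (hp : 0 ≤ p) (hq : 0 ≤ q)
    (h : δ * (n * (p + q)) ≤ 1) {f : ParticleConfig n → ℝ} (hf : Monotone f) (j : ℕ) :
    Monotone ((lazyStep δ p q)^[j] f) := by
  induction j with
  | zero => exact hf
  | succ j ih =>
    rw [Function.iterate_succ_apply']
    exact lazyStep_monotone hδ hp hq h ih

theorem iterate_lazyStep_nonneg {δ p q : ℝ} (hδ : 0 ≤ δ) (hp : 0 ≤ p) (hq : 0 ≤ q)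
    (h : δ * (n * (p + q)) ≤ 1) {f : ParticleConfig n → ℝ} (hf : ∀ z, 0 ≤ f z) (j : ℕ)
    (z : ParticleConfig n) : 0 ≤ (lazyStep δ p q)^[j] f z := by
  induction j generalizing z with
  | zero => exact hf z
  | succ j ih =>
    rw [Function.iterate_succ_apply']
    refine le_trans ?_ (lazyStep_le_lazyStep hδ hp hq h ih z)
    rw [lazyStep_const]

theorem sum_jumpLeft_sub (φ : Fin n → ℕ → ℝ) (k : Fin n) (z : ParticleConfig n) :
    ∑ l, φ l ((jumpLeft k z).1 l) - ∑ l, φ l (z.1 l) =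
      φ k ((jumpLeft k z).1 k) - φ k (z.1 k) := by
  rw [← Finset.sum_sub_distrib, Finset.sum_eq_single k]
  · intro l _ hl
    rw [jumpLeft_of_ne hl, sub_self]
  · simp

theorem sum_jumpRight_sub (φ : Fin n → ℕ → ℝ) (k : Fin n) (z : ParticleConfig n) :
    ∑ l, φ l ((jumpRight k z).1 l) - ∑ l, φ l (z.1 l) =
      φ k ((jumpRight k z).1 k) - φ k (z.1 k) := by
  rw [← Finset.sum_sub_distrib, Finset.sum_eq_single k]
  · intro l _ hl
    rw [jumpRight_of_ne hl, sub_self]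
  · simp

theorem coe_jumpRight_le (k : Fin n) (z : ParticleConfig n) :
    ((jumpRight k z).1 k : ℕ) ≤ z.1 k + 1 := by
  rcases jumpRight_cases k z with ⟨e, -⟩ | ⟨-, -, e⟩
  · rw [e]; omega
  · omega

/-! ### Lyapunov functions -/

/-- An exponential function of the positions that is driven down outside of a bounded region. -/
theorem exists_exponential_lyapunov {p q : ℝ} (hq : 0 ≤ q) (hqp : q < p) :
    ∃ f : ParticleConfig n → ℝ, Monotone f ∧ (∀ z, 0 ≤ f z) ∧
      ∃ ε > 0, ∃ C > 0, (∀ z, drift p q f z ≤ C - ε * f z) ∧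
      ∃ c > 0, ∀ z, ((∑ k, (z.1 k : ℕ) : ℕ) : ℝ) ≤ c * f z := by
  have hp : 0 < p := hq.trans_lt hqp
  have hn : (0 : ℝ) < n := Nat.cast_pos.2 n.pos
  -- The choice gives `1 < θ` and `q * θ < p`, so an unblocked particle has negative drift for `θ ^
  -- m`.
  set θ : ℝ := 2 * p / (p + q) with hθ
  have hpq : 0 < p + q := by linarith
  have hθ1 : 1 < θ := by rw [hθ, lt_div_iff₀ hpq]; linarith
  have hθ0 : 0 < θ := by linarith
  have hqθ : q * θ < p := by
    rw [hθ, mul_div_assoc', div_lt_iff₀ hpq]; nlinarith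
  set ε : ℝ := (θ - 1) * (p / θ - q) with hε
  have hε0 : 0 < ε := by
    refine mul_pos (by linarith) (sub_pos.2 ?_)
    rwa [lt_div_iff₀ hθ0]
  set B : ℝ := n * (p * (θ - 1)) with hB
  have hB0 : 0 < B := mul_pos hn (mul_pos hp (by linarith))
  -- Particle `k` gets weight `l ^ k`. The small ratio `l` makes the total effect of particles
  -- blocking each other at most half of the decay.
  set l : ℝ := min 1 (ε / (2 * B)) with hl
  have hl0 : 0 < l := lt_min one_pos (by positivity)
  have hl1 : l ≤ 1 := min_le_left _ _
  have hlB : B * l ≤ ε / 2 := by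
    calc B * l ≤ B * (ε / (2 * B)) := by gcongr; exact min_le_right _ _
      _ = ε / 2 := by field_simp
  set φ : Fin n → ℕ → ℝ := fun k m => l ^ (k : ℕ) * θ ^ m with hφ
  set f : ParticleConfig n → ℝ := fun z => ∑ k, φ k (z.1 k) with hf
  have hφ0 : ∀ k m, 0 ≤ φ k m := fun k m => by positivity
  have hf0 : ∀ z, 0 ≤ f z := fun z => Finset.sum_nonneg fun k _ => hφ0 _ _
  have hfk : ∀ z k, φ k (z.1 k) ≤ f z := fun z k =>
    Finset.single_le_sum (f := fun k => φ k (z.1 k)) (fun k _ => hφ0 _ _) (Finset.mem_univ k)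
  refine ⟨f, ?_, hf0, ε / 2, by positivity, B, hB0, ?_, ?_⟩
  · intro z w hzw
    refine Finset.sum_le_sum fun k _ => ?_
    simp only [hφ]
    gcongr
    · exact hθ1.le
    · exact hzw k
  · intro z
    have hterm : ∀ k, p * (f (jumpLeft k z) - f z) + q * (f (jumpRight k z) - f z) ≤
        p * (θ - 1) * (1 + l * f z) - ε * φ k (z.1 k) := by
      intro k
      have h1 : f (jumpLeft k z) - f z = φ k ((jumpLeft k z).1 k) - φ k (z.1 k) :=
        sum_jumpLeft_sub φ k z
      have h2 : f (jumpRight k z) - f z = φ k ((jumpRight k z).1 k) - φ k (z.1 k) :=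
        sum_jumpRight_sub φ k z
      have h3 : φ k ((jumpRight k z).1 k) ≤ φ k (z.1 k) * θ := by
        simp only [hφ]
        rw [mul_assoc, ← pow_succ]
        gcongr
        · exact hθ1.le
        · exact coe_jumpRight_le k z
      have h4 : ε * φ k (z.1 k) =
          (θ - 1) * p * (φ k (z.1 k) / θ) - q * (φ k (z.1 k) * θ - φ k (z.1 k)) := by
        rw [hε]; ring
      have h5 : p * (φ k ((jumpLeft k z).1 k) - φ k (z.1 k)) ≤
          p * (θ - 1) * (1 + l * f z) - (θ - 1) * p * (φ k (z.1 k) / θ) := by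
        have hpos : 0 ≤ p * (θ - 1) := mul_nonneg hp.le (by linarith)
        rcases jumpLeft_cases k z with ⟨e, h⟩ | ⟨-, -, -, h⟩
        · rw [e, sub_self, mul_zero]
          have h6 : φ k (z.1 k) / θ ≤ 1 + l * f z := by
            -- The wall costs at most a constant. A blocking particle `m < k` sits one slot lower
            -- and has a weight larger by a factor of at least `1 / l`.
            rcases h with h | ⟨m, hm, h⟩
            · rw [h]
              have : φ k 1 / θ = l ^ (k : ℕ) := by
                simp only [hφ]; field_simp
              rw [this]
              have := pow_le_one₀ hl0.le hl1 (n := (k : ℕ))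
              have := mul_nonneg hl0.le (hf0 z)
              linarith
            · have h7 : φ k (z.1 k) / θ = l ^ (k : ℕ) * θ ^ (z.1 m : ℕ) := by
                simp only [hφ]
                rw [← h, pow_succ]; field_simp
              have h8 : l ^ (k : ℕ) ≤ l ^ ((m : ℕ) + 1) := pow_le_pow_of_le_one hl0.le hl1 hm
              have h9 := hfk z m
              have h10 : l ^ (k : ℕ) * θ ^ (z.1 m : ℕ) ≤ l * φ m (z.1 m) := by
                calc _ ≤ l ^ ((m : ℕ) + 1) * θ ^ (z.1 m : ℕ) := by gcongr
                  _ = _ := by simp only [hφ]; ring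
              have h11 := mul_le_mul_of_nonneg_left h9 hl0.le
              rw [h7]; linarith
          have := mul_le_mul_of_nonneg_left h6 hpos
          linarith
        · have h6 : φ k ((jumpLeft k z).1 k) = φ k (z.1 k) / θ := by
            simp only [hφ]
            rw [← h, pow_succ]; field_simp
          rw [h6]
          have h7 : φ k (z.1 k) = φ k (z.1 k) / θ * θ := by field_simp
          have h8 : 0 ≤ p * (θ - 1) * (1 + l * f z) :=
            mul_nonneg hpos (by have := mul_nonneg hl0.le (hf0 z); linarith)
          nlinarith
      have h6 : q * (φ k ((jumpRight k z).1 k) - φ k (z.1 k)) ≤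
          q * (φ k (z.1 k) * θ - φ k (z.1 k)) := by gcongr
      rw [h1, h2, h4]
      linarith
    have hsum : drift p q f z ≤ ∑ k : Fin n, (p * (θ - 1) * (1 + l * f z) - ε * φ k (z.1 k)) :=
      Finset.sum_le_sum fun k _ => hterm k
    rw [Finset.sum_sub_distrib, Finset.sum_const, Finset.card_univ, Fintype.card_fin,
      nsmul_eq_mul, ← Finset.mul_sum] at hsum
    have h1 : (n : ℝ) * (p * (θ - 1) * (1 + l * f z)) = B + B * l * f z := by
      rw [hB]; ring
    have h2 := mul_le_mul_of_nonneg_right hlB (hf0 z)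
    have h3 : ∑ k, φ k (z.1 k) = f z := rfl
    rw [h3] at hsum
    have h4 : ((n : ℕ) : ℝ) * (p * (θ - 1) * (1 + l * f z)) = B + B * l * f z := h1
    linarith
  · have hc : 0 < (θ - 1) * l ^ (n : ℕ) := mul_pos (by linarith) (by positivity)
    refine ⟨1 / ((θ - 1) * l ^ (n : ℕ)), by positivity, fun z => ?_⟩
    rw [one_div, ← div_eq_inv_mul, le_div_iff₀ hc]
    push_cast
    rw [Finset.sum_mul]
    refine Finset.sum_le_sum fun k _ => ?_
    have h1 := one_add_mul_sub_le_pow (show -1 ≤ θ by linarith) (z.1 k : ℕ)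
    have h2 : l ^ (n : ℕ) ≤ l ^ (k : ℕ) := pow_le_pow_of_le_one hl0.le hl1 k.2.le
    have h3 : (0 : ℝ) ≤ θ ^ (z.1 k : ℕ) := by positivity
    have h4 : 0 ≤ l ^ (n : ℕ) := by positivity
    calc (z.1 k : ℝ) * ((θ - 1) * l ^ (n : ℕ))
        = ((z.1 k : ℕ) * (θ - 1)) * l ^ (n : ℕ) := by ring
      _ ≤ θ ^ (z.1 k : ℕ) * l ^ (n : ℕ) := by gcongr; linarith
      _ ≤ θ ^ (z.1 k : ℕ) * l ^ (k : ℕ) := by gcongr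
      _ = φ k (z.1 k) := by simp only [hφ]; ring

/-- A bounded function of the positions that is driven down outside of the packed
configuration. -/
theorem exists_bounded_lyapunov {p q : ℝ} (hp : 0 < p) (hq : 0 ≤ q) :
    ∃ r : ℝ, 0 < r ∧ r < 1 ∧ ∃ κ > 0, ∀ z : ParticleConfig n, z ≠ packed n →
      drift p q (fun z => 1 - r ^ (∑ k, (z.1 k : ℕ))) z ≤ -(κ * r ^ (∑ k, (z.1 k : ℕ))) := by
  have hn : (0 : ℝ) < n := Nat.cast_pos.2 n.pos
  have hd : 0 < 2 * (n * q + p) := by positivity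
  -- So small that one possible left jump outweighs all `n` right jumps: `n * q * r ≤ p / 2`.
  set r : ℝ := p / (2 * (n * q + p)) with hr
  have hr0 : 0 < r := by positivity
  have hnq : 0 ≤ (n : ℝ) * q := by positivity
  have hr1 : r < 1 := by rw [hr, div_lt_one hd]; linarith
  have hnqr : n * q * r ≤ p / 2 := by
    rw [hr, mul_div_assoc', div_le_iff₀ hd]; nlinarith
  refine ⟨r, hr0, hr1, (1 - r) * (p / 2), mul_pos (by linarith) (by positivity), ?_⟩
  intro z hz
  set N : ParticleConfig n → ℕ := fun z => ∑ k, (z.1 k : ℕ) with hN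
  change drift p q (fun z => 1 - r ^ N z) z ≤ -((1 - r) * (p / 2) * r ^ N z)
  have hmono : Monotone N := fun z w h => Finset.sum_le_sum fun k _ => (PNat.coe_le_coe _ _).2 (h k)
  obtain ⟨k₀, hk₀⟩ : ∃ k, jumpLeft k z ≠ z := by
    by_contra! h
    exact hz (eq_packed_of_jumpLeft h)
  have hNk₀ : N (jumpLeft k₀ z) + 1 = N z := by
    rcases jumpLeft_cases k₀ z with ⟨e, -⟩ | ⟨-, -, -, e⟩
    · exact absurd e hk₀
    · have h1 := sum_jumpLeft_sub (fun _ m => (m : ℝ)) k₀ z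
      have h2 : ((N (jumpLeft k₀ z) : ℕ) : ℝ) - (N z : ℕ) =
          ((jumpLeft k₀ z).1 k₀ : ℕ) - (z.1 k₀ : ℕ) := by
        simp only [hN]; push_cast; exact h1
      have h3 : ((z.1 k₀ : ℕ) : ℝ) = ((jumpLeft k₀ z).1 k₀ : ℕ) + 1 := by
        rw [← e]; push_cast; rfl
      rw [h3] at h2
      have : ((N (jumpLeft k₀ z) + 1 : ℕ) : ℝ) = (N z : ℕ) := by push_cast; linarith
      exact_mod_cast this
  have hNr : ∀ k, N (jumpRight k z) ≤ N z + 1 := by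
    intro k
    have h1 := sum_jumpRight_sub (fun _ m => (m : ℝ)) k z
    have h2 : ((N (jumpRight k z) : ℕ) : ℝ) - (N z : ℕ) =
        ((jumpRight k z).1 k : ℕ) - (z.1 k : ℕ) := by
      simp only [hN]; push_cast; exact h1
    have h3 : (((jumpRight k z).1 k : ℕ) : ℝ) ≤ (z.1 k : ℕ) + 1 := by
      exact_mod_cast coe_jumpRight_le k z
    have : ((N (jumpRight k z) : ℕ) : ℝ) ≤ (N z + 1 : ℕ) := by push_cast; linarith
    exact_mod_cast this
  have hR : ∀ k, q * ((1 - r ^ N (jumpRight k z)) - (1 - r ^ N z)) ≤ q * ((1 - r) * r ^ N z) := by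
    intro k
    have h1 : r ^ (N z + 1) ≤ r ^ N (jumpRight k z) := pow_le_pow_of_le_one hr0.le hr1.le (hNr k)
    rw [pow_succ] at h1
    gcongr
    linarith
  have hL : ∀ k, p * ((1 - r ^ N (jumpLeft k z)) - (1 - r ^ N z)) ≤
      if k = k₀ then -(p * ((1 - r) * r ^ N (jumpLeft k₀ z))) else 0 := by
    intro k
    split_ifs with h
    · subst h
      have h1 : r ^ N z = r ^ N (jumpLeft k z) * r := by rw [← hNk₀, pow_succ]
      rw [h1]
      exact le_of_eq (by ring)
    · have h2 : r ^ N z ≤ r ^ N (jumpLeft k z) :=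
        pow_le_pow_of_le_one hr0.le hr1.le (hmono (jumpLeft_le k z))
      exact mul_nonpos_of_nonneg_of_nonpos hp.le (by linarith)
  have hsum : drift p q (fun z => 1 - r ^ N z) z ≤
      ∑ k, ((if k = k₀ then -(p * ((1 - r) * r ^ N (jumpLeft k₀ z))) else 0) +
        q * ((1 - r) * r ^ N z)) :=
    Finset.sum_le_sum fun k _ => add_le_add (hL k) (hR k)
  rw [Finset.sum_add_distrib, Finset.sum_ite_eq' , if_pos (Finset.mem_univ _), Finset.sum_const,
    Finset.card_univ, Fintype.card_fin, nsmul_eq_mul] at hsum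
  refine hsum.trans ?_
  have h1 : r ^ N z = r ^ N (jumpLeft k₀ z) * r := by rw [← hNk₀, pow_succ]
  have h2 : 0 ≤ (1 - r) * r ^ N (jumpLeft k₀ z) := mul_nonneg (by linarith) (by positivity)
  have h3 := mul_le_mul_of_nonneg_right hnqr h2
  have h4 := mul_le_mul_of_nonneg_left hr1.le (mul_nonneg (half_pos hp).le h2)
  rw [h1]
  have h5 : ((n : ℕ) : ℝ) * (q * ((1 - r) * (r ^ N (jumpLeft k₀ z) * r))) =
    n * q * r * ((1 - r) * r ^ N (jumpLeft k₀ z)) := by ring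
  rw [h5]
  linarith

/-- A function of the configuration that decreases at an exponential rate until the process is
packed. -/
theorem exists_lyapunov {p q : ℝ} (hq : 0 ≤ q) (hqp : q < p) :
    ∃ Φ : ParticleConfig n → ℝ, Monotone Φ ∧ (∀ z, 1 ≤ Φ z) ∧
      ∃ ε > 0, ∀ z, z ≠ packed n → drift p q Φ z ≤ -(ε * Φ z) := by
  have hp : 0 < p := hq.trans_lt hqp
  obtain ⟨f, hfm, hf0, ε₁, hε₁, C, hC, hfd, c, hc, hN⟩ :=
    exists_exponential_lyapunov (n := n) hq hqp
  obtain ⟨r, hr0, hr1, κ, hκ, hψ⟩ := exists_bounded_lyapunov (n := n) hp hq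
  set N : ParticleConfig n → ℕ := fun z => ∑ k, (z.1 k : ℕ) with hNdef
  have hmono : Monotone N := fun z w h => Finset.sum_le_sum fun k _ => (PNat.coe_le_coe _ _).2 (h k)
  set M : ℝ := 2 * C / ε₁ with hM
  have hM0 : 0 < M := by positivity
  -- Where `f < M` and the configuration is not packed, the bounded function has drift at most `-2 *
  -- D`; with `b * C = D` the term `b * f` spoils at most half of this.
  set D : ℝ := κ * r ^ ⌈c * M⌉₊ / 2 with hD
  have hD0 : 0 < D := by positivity
  set b : ℝ := D / C with hb
  have hb0 : 0 < b := by positivity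
  have hbC : b * C = D := by rw [hb]; field_simp
  set ε : ℝ := min (ε₁ / 4) (min (b * C / 4) (D / (2 + b * M))) with hε
  have hε0 : 0 < ε := lt_min (by positivity) (lt_min (by positivity) (by positivity))
  have hψ0 : ∀ z, 0 ≤ 1 - r ^ N z := fun z => sub_nonneg.2 (pow_le_one₀ hr0.le hr1.le)
  refine ⟨fun z => 1 + ((1 - r ^ N z) + b * f z), ?_, ?_, ε, hε0, ?_⟩
  · intro z w hzw
    have h1 := hfm hzw
    have h2 : r ^ N w ≤ r ^ N z := pow_le_pow_of_le_one hr0.le hr1.le (hmono hzw)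
    simp only
    gcongr
  · intro z
    have := mul_nonneg hb0.le (hf0 z)
    have := hψ0 z
    simp only
    linarith
  · intro z hz
    rw [drift_const_add, drift_add, drift_const_mul]
    have h1 := hψ z hz
    change drift p q (fun z => 1 - r ^ N z) z ≤ -(κ * r ^ N z) at h1
    have h2 := mul_le_mul_of_nonneg_left (hfd z) hb0.le
    have hrN : 0 < r ^ N z := by positivity
    have h3 : 0 ≤ κ * r ^ N z := by positivity
    have h4 : 1 + ((1 - r ^ N z) + b * f z) ≤ 2 + b * f z := by linarith
    have h5 := mul_le_mul_of_nonneg_left h4 hε0.le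
    have hf := hf0 z
    -- For `f z ≥ M` the decay `ε₁ * f z` is at least `2 * C` and the exponential part wins; for `f
    -- z < M` the sum of the positions is bounded and the bounded part wins.
    rcases le_or_gt M (f z) with h | h
    · have h6 : ε ≤ ε₁ / 4 := min_le_left _ _
      have h7 : ε ≤ b * C / 4 := (min_le_right _ _).trans (min_le_left _ _)
      have h8 : 2 * C ≤ ε₁ * f z := by
        rw [hM, div_le_iff₀ hε₁] at h; linarith
      have h9 := mul_le_mul_of_nonneg_left h8 hb0.le
      have h10 := mul_le_mul_of_nonneg_right h6 (mul_nonneg hb0.le hf)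
      nlinarith
    · have h6 : ε ≤ D / (2 + b * M) := (min_le_right _ _).trans (min_le_right _ _)
      rw [le_div_iff₀ (by positivity)] at h6
      have h7 : N z ≤ ⌈c * M⌉₊ := by
        have h8 : ((N z : ℕ) : ℝ) ≤ c * M := (hN z).trans (by gcongr)
        exact_mod_cast h8.trans (Nat.le_ceil _)
      have h8 : r ^ ⌈c * M⌉₊ ≤ r ^ N z := pow_le_pow_of_le_one hr0.le hr1.le h7
      have h9 : 2 * D ≤ κ * r ^ N z := by
        rw [hD]; have := mul_le_mul_of_nonneg_left h8 hκ.le; linarith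
      have h10 : ε * (2 + b * f z) ≤ ε * (2 + b * M) := by gcongr
      have h11 : 0 ≤ b * (ε₁ * f z) := by positivity
      linarith

/-! ### Forgetting the initial configuration -/

/-- Started from `z`, the lazy process forgets its initial state at an exponential rate. -/
theorem iterate_lazyStep_le {δ p q ε : ℝ} (hδ : 0 ≤ δ) (hp : 0 ≤ p) (hq : 0 ≤ q)
    (h : δ * (n * (p + q)) ≤ 1) (hε : δ * ε ≤ 1) {Φ : ParticleConfig n → ℝ} (hΦ1 : ∀ z, 1 ≤ Φ z)
    (hΦ : ∀ z, z ≠ packed n → drift p q Φ z ≤ -(ε * Φ z))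
    {g : ParticleConfig n → ℝ} (hg : Monotone g) (hg0 : ∀ z, 0 ≤ g z) (hg1 : ∀ z, g z ≤ 1)
    (j : ℕ) (z : ParticleConfig n) :
    (lazyStep δ p q)^[j] g z ≤ (lazyStep δ p q)^[j] g (packed n) + (1 - δ * ε) ^ j * Φ z := by
  have hρ : 0 ≤ 1 - δ * ε := by linarith
  induction j generalizing z with
  | zero =>
    have := hg0 (packed n)
    have := hg1 z
    have := hΦ1 z
    simp only [Function.iterate_zero, id, pow_zero, one_mul]
    linarith
  | succ j ih =>
    rw [Function.iterate_succ_apply']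
    by_cases hz : z = packed n
    · subst hz
      have : 0 ≤ (1 - δ * ε) ^ (j + 1) * Φ (packed n) :=
        mul_nonneg (pow_nonneg hρ _) (zero_le_one.trans (hΦ1 _))
      linarith
    · have h1 := lazyStep_le_lazyStep hδ hp hq h ih z
      rw [lazyStep_const_add, lazyStep_const_mul] at h1
      -- The packed configuration is the least one, so the value there does not decrease with `j`.
      -- Thus the drift of `Φ` is needed only off the packed configuration.
      have h2 : (lazyStep δ p q)^[j] g (packed n) ≤
          lazyStep δ p q ((lazyStep δ p q)^[j] g) (packed n) := by
        rw [← lazyStep_const δ p q ((lazyStep δ p q)^[j] g (packed n)) (packed n)]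
        exact lazyStep_le_lazyStep hδ hp hq h (fun w => by
          exact iterate_lazyStep_monotone hδ hp hq h hg j (packed_le w)) _
      have h3 : lazyStep δ p q Φ z ≤ (1 - δ * ε) * Φ z := by
        have := mul_le_mul_of_nonneg_left (hΦ z hz) hδ
        rw [lazyStep]; linarith
      have h4 := mul_le_mul_of_nonneg_left h3 (pow_nonneg hρ j)
      rw [pow_succ, mul_assoc]
      linarith

/-! ### Stationarity as invariance of expectations -/

open Classical in
theorem jumpRate_eq (p q : ℝ≥0) (w z : ParticleConfig n) :
    jumpRate p q w z = ∑ j,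
      ((if z = jumpLeft j w then (if jumpLeft j w = w then 0 else (p : ℝ≥0∞)) else 0) +
      (if z = jumpRight j w then (if jumpRight j w = w then 0 else (q : ℝ≥0∞)) else 0)) := by
  unfold jumpRate
  refine Finset.sum_congr rfl fun j _ => ?_
  rw [movesRight_iff_jumpLeft (z := w) (w := z), movesRight_iff_jumpRight (z := w) (w := z)]
  congr 1
  · by_cases h : z = jumpLeft j w
    · by_cases h' : jumpLeft j w = w <;> simp [h, h']
    · simp [h, Ne.symm h]
  · by_cases h : z = jumpRight j w
    · by_cases h' : jumpRight j w = w <;> simp [h, h']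
    · simp [h, Ne.symm h]

open Classical in
theorem tsum_jumpRate_mul (p q : ℝ≥0) (w : ParticleConfig n) (F : ParticleConfig n → ℝ≥0∞) :
    ∑' z, jumpRate p q w z * F z =
      ∑ j, ((if jumpLeft j w = w then 0 else (p : ℝ≥0∞)) * F (jumpLeft j w) +
        (if jumpRight j w = w then 0 else (q : ℝ≥0∞)) * F (jumpRight j w)) := by
  simp only [jumpRate_eq, Finset.sum_mul, add_mul, ite_mul, zero_mul]
  rw [Summable.tsum_finsetSum fun _ _ => ENNReal.summable]
  refine Finset.sum_congr rfl fun j _ => ?_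
  rw [ENNReal.tsum_add, tsum_eq_single (jumpLeft j w) fun z hz => if_neg hz, if_pos rfl,
    tsum_eq_single (jumpRight j w) fun z hz => if_neg hz, if_pos rfl]

/-- Blocked attempts do not enter `jumpRate`. Adding them as loops `B` to both sides of the balance
equations makes the total rate the constant `n * (p + q)`. -/
theorem tsum_stationary {p q : ℝ≥0} {μ : PMF (ParticleConfig n)}
    (hμ : ∀ w, μ w * ∑' z, jumpRate p q w z = ∑' z, μ z * jumpRate p q z w)
    (F : ParticleConfig n → ℝ≥0∞) :
    ∑' w, μ w * ∑ j, (p * F (jumpLeft j w) + q * F (jumpRight j w)) =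
      n * (p + q) * ∑' w, μ w * F w := by
  classical
  set B : ParticleConfig n → ℝ≥0∞ := fun w =>
    ∑ j, ((if jumpLeft j w = w then (p : ℝ≥0∞) else 0) +
      (if jumpRight j w = w then (q : ℝ≥0∞) else 0)) with hB
  have h1 : ∀ w, ∑ j, (p * F (jumpLeft j w) + q * F (jumpRight j w)) =
      ∑' z, jumpRate p q w z * F z + B w * F w := by
    intro w
    rw [tsum_jumpRate_mul, hB, Finset.sum_mul, ← Finset.sum_add_distrib]
    refine Finset.sum_congr rfl fun j _ => ?_
    by_cases h : jumpLeft j w = w <;> by_cases h' : jumpRight j w = w <;> simp [h, h'] <;> ring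
  have h2 : ∀ w, ∑' z, jumpRate p q w z + B w = n * (p + q) := by
    intro w
    have := tsum_jumpRate_mul p q w 1
    simp only [Pi.one_apply, mul_one] at this
    rw [this, hB, ← Finset.sum_add_distrib]
    rw [Finset.sum_congr rfl (g := fun _ => (p : ℝ≥0∞) + q)]
    · rw [Finset.sum_const, Finset.card_univ, Fintype.card_fin, nsmul_eq_mul]
    · intro j _
      by_cases h : jumpLeft j w = w <;> by_cases h' : jumpRight j w = w <;> simp [h, h', add_comm]
  have h3 : ∑' w, μ w * ∑' z, jumpRate p q w z * F z =
      ∑' z, μ z * (∑' w, jumpRate p q z w) * F z := by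
    simp only [← ENNReal.tsum_mul_left]
    rw [ENNReal.tsum_comm]
    refine tsum_congr fun z => ?_
    rw [ENNReal.tsum_mul_left, hμ z, ← ENNReal.tsum_mul_right]
    exact tsum_congr fun w => by ring
  simp only [h1, mul_add]
  rw [ENNReal.tsum_add, h3, ← ENNReal.tsum_add, ← mul_add, ← ENNReal.tsum_mul_left]
  refine tsum_congr fun w => ?_
  rw [← h2 w]
  ring

/-- A stationary law does not depend on the speed of the process; the factor `s` turns the
normalized rates into the request probabilities. -/
theorem tsum_ofReal_lazyStep {p' q' : ℝ≥0} {μ : PMF (ParticleConfig n)}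
    (hμ : ∀ w, μ w * ∑' z, jumpRate p' q' w z = ∑' z, μ z * jumpRate p' q' z w)
    {s δ : ℝ} (hs : 0 ≤ s) (hδ : 0 ≤ δ) (h : δ * (n * (s * p' + s * q')) ≤ 1)
    {f : ParticleConfig n → ℝ} (hf : ∀ z, 0 ≤ f z) :
    ∑' z, μ z * ENNReal.ofReal (lazyStep δ (s * p') (s * q') f z) =
      ∑' z, μ z * ENNReal.ofReal (f z) := by
  set a : ℝ := 1 - δ * (n * (s * p' + s * q')) with ha
  have ha0 : 0 ≤ a := by linarith
  have hδs : 0 ≤ δ * s := mul_nonneg hδ hs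
  have h1 : ∀ z, ENNReal.ofReal (lazyStep δ (s * p') (s * q') f z) =
      ENNReal.ofReal a * ENNReal.ofReal (f z) + ENNReal.ofReal (δ * s) *
        ∑ j, (p' * ENNReal.ofReal (f (jumpLeft j z)) + q' * ENNReal.ofReal (f (jumpRight j z))) := by
    intro z
    have h2 : ∀ j, 0 ≤ (p' : ℝ) * f (jumpLeft j z) + q' * f (jumpRight j z) := fun j =>
      add_nonneg (mul_nonneg p'.coe_nonneg (hf _)) (mul_nonneg q'.coe_nonneg (hf _))
    have h3 : lazyStep δ (s * p') (s * q') f z =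
        a * f z + (δ * s) * ∑ j, ((p' : ℝ) * f (jumpLeft j z) + q' * f (jumpRight j z)) := by
      rw [lazyStep_eq, mul_assoc δ s, Finset.mul_sum _ _ s]
      congr 2
      exact Finset.sum_congr rfl fun _ _ => by ring
    rw [h3, ENNReal.ofReal_add (mul_nonneg ha0 (hf z))
      (mul_nonneg hδs (Finset.sum_nonneg fun j _ => h2 j)), ENNReal.ofReal_mul ha0,
      ENNReal.ofReal_mul hδs, ENNReal.ofReal_sum_of_nonneg fun j _ => h2 j]
    congr 2
    refine Finset.sum_congr rfl fun j _ => ?_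
    rw [ENNReal.ofReal_add (mul_nonneg p'.coe_nonneg (hf _)) (mul_nonneg q'.coe_nonneg (hf _)),
      ENNReal.ofReal_mul p'.coe_nonneg, ENNReal.ofReal_mul q'.coe_nonneg, ENNReal.ofReal_coe_nnreal,
      ENNReal.ofReal_coe_nnreal]
  simp only [h1, mul_add]
  rw [ENNReal.tsum_add]
  have h4 : ∑' z, μ z * (ENNReal.ofReal (δ * s) *
      ∑ j, (p' * ENNReal.ofReal (f (jumpLeft j z)) + q' * ENNReal.ofReal (f (jumpRight j z)))) =
      ENNReal.ofReal (δ * s) * (n * (p' + q') * ∑' z, μ z * ENNReal.ofReal (f z)) := by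
    rw [← tsum_stationary hμ, ← ENNReal.tsum_mul_left]
    exact tsum_congr fun z => by ring
  have h5 : ∑' z, μ z * (ENNReal.ofReal a * ENNReal.ofReal (f z)) =
      ENNReal.ofReal a * ∑' z, μ z * ENNReal.ofReal (f z) := by
    rw [← ENNReal.tsum_mul_left]
    exact tsum_congr fun z => by ring
  have h6 : ENNReal.ofReal a + ENNReal.ofReal (δ * s) * (n * (p' + q')) = 1 := by
    have h7 : ((n : ℝ≥0∞) * (p' + q')) = ENNReal.ofReal (n * (p' + q')) := by
      rw [ENNReal.ofReal_mul (by positivity), ENNReal.ofReal_add p'.coe_nonneg q'.coe_nonneg,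
        ENNReal.ofReal_coe_nnreal, ENNReal.ofReal_coe_nnreal, ENNReal.ofReal_natCast]
    rw [h7, ← ENNReal.ofReal_mul hδs, ← ENNReal.ofReal_add ha0 (by positivity),
      ← ENNReal.ofReal_one]
    congr 1
    rw [ha]; ring
  have h8 : ((n : ℕ) : ℝ≥0∞) = (n : ℝ≥0∞) := rfl
  rw [h4, h5, ← mul_assoc, ← add_mul, h6, one_mul]

theorem iterate_lazyStep_packed_le {p' q' : ℝ≥0} {μ : PMF (ParticleConfig n)}
    (hμ : ∀ w, μ w * ∑' z, jumpRate p' q' w z = ∑' z, μ z * jumpRate p' q' z w)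
    {s δ : ℝ} (hs : 0 ≤ s) (hδ : 0 ≤ δ) (h : δ * (n * (s * p' + s * q')) ≤ 1)
    {g : ParticleConfig n → ℝ} (hg : Monotone g) (hg0 : ∀ z, 0 ≤ g z) (j : ℕ) :
    ENNReal.ofReal ((lazyStep δ (s * p') (s * q'))^[j] g (packed n)) ≤
      ∑' z, μ z * ENNReal.ofReal (g z) := by
  have hp : 0 ≤ s * p' := mul_nonneg hs p'.coe_nonneg
  have hq : 0 ≤ s * q' := mul_nonneg hs q'.coe_nonneg
  have h1 : ∑' z, μ z * ENNReal.ofReal ((lazyStep δ (s * p') (s * q'))^[j] g z) =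
      ∑' z, μ z * ENNReal.ofReal (g z) := by
    induction j with
    | zero => rfl
    | succ j ih =>
      rw [← ih, Function.iterate_succ_apply']
      exact tsum_ofReal_lazyStep hμ hs hδ h (iterate_lazyStep_nonneg hδ hp hq h hg0 j)
  rw [← h1]
  calc _ = ∑' z, μ z * ENNReal.ofReal ((lazyStep δ (s * p') (s * q'))^[j] g (packed n)) := by
        rw [ENNReal.tsum_mul_right, μ.tsum_coe, one_mul]
    _ ≤ _ := by
        gcongr
        exact iterate_lazyStep_monotone hδ hp hq h hg j (packed_le _)

/-! ### Existence and nonexistence of stationary laws -/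

theorem tsum_prod_geometric_ne_top {b : ℝ≥0} (hb : b < 1) (m : ℕ) :
    ∑' y : Fin m → ℕ, ∏ k, (b : ℝ≥0∞) ^ y k ≠ ⊤ := by
  induction m with
  | zero => simp
  | succ m ih =>
    rw [← (Fin.consEquiv fun _ : Fin (m + 1) => ℕ).tsum_eq, ENNReal.tsum_prod']
    simp only [Fin.consEquiv, Equiv.coe_fn_mk, Fin.prod_univ_succ, Fin.cons_zero, Fin.cons_succ]
    simp only [ENNReal.tsum_mul_left, ENNReal.tsum_mul_right]
    refine ENNReal.mul_ne_top ?_ ih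
    rw [ENNReal.tsum_geometric]
    exact ENNReal.inv_ne_top.2 (tsub_pos_of_lt (by exact_mod_cast hb)).ne'

/-- For `β < 1` the geometric weights are reversible, so that there is a stationary law. -/
theorem exists_stationaryLaw {b : ℝ≥0} (hb : b < 1) :
    ∃ μ : PMF (ParticleConfig n), IsStationaryLaw n b μ := by
  set m : ParticleConfig n → ℝ≥0∞ := fun z => ∏ k, (b : ℝ≥0∞) ^ ((z.1 k : ℕ) - (k + 1)) with hm
  have hle : ∀ (z : ParticleConfig n) (k : Fin n), (k : ℕ) + 1 ≤ z.1 k := fun z k =>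
    (PNat.coe_le_coe _ _).2 (packed_le z k)
  have hm0 : ∑' z, m z ≠ 0 := by
    intro h
    have := ENNReal.tsum_eq_zero.1 h (packed n)
    have h2 : m (packed n) = 1 := by
      refine Finset.prod_eq_one fun k _ => ?_
      have : ((packed n).1 k : ℕ) - (k + 1) = 0 := Nat.sub_self _
      rw [this, pow_zero]
    rw [h2] at this
    exact one_ne_zero this
  have hmt : ∑' z, m z ≠ ⊤ := by
    refine ne_top_of_le_ne_top (tsum_prod_geometric_ne_top hb n) ?_
    -- The deviations from the packed positions determine the configuration; dropping the order
    -- constraint on them leaves a product of geometric series.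
    refine ENNReal.tsum_comp_le_tsum_of_injective
      (f := fun (z : ParticleConfig n) (k : Fin n) => (z.1 k : ℕ) - (k + 1)) ?_
      (fun y : Fin n → ℕ => ∏ k, (b : ℝ≥0∞) ^ y k)
    intro z w h
    refine Subtype.ext (funext fun k => PNat.eq ?_)
    have h1 := congrFun h k
    have h2 := hle z k
    have h3 := hle w k
    simp only at h1
    omega
  have hstep : ∀ j (z w : ParticleConfig n), MovesRight j z w → m w = b * m z := by
    intro j z w h
    unfold MovesRight at h
    simp only [hm]
    rw [← Finset.mul_prod_erase _ _ (Finset.mem_univ j),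
      ← Finset.mul_prod_erase (a := j) _ (fun k => (b : ℝ≥0∞) ^ ((z.1 k : ℕ) - (k + 1)))
        (Finset.mem_univ j), ← mul_assoc, ← pow_succ']
    congr 1
    · have h1 : (w.1 j : ℕ) = z.1 j + 1 := by rw [h, Function.update_self]; simp
      have := hle z j
      congr 1
      omega
    · refine Finset.prod_congr rfl fun k hk => ?_
      rw [h, Function.update_of_ne (Finset.ne_of_mem_erase hk)]
  have hrate : ((b / (1 + b) : ℝ≥0) : ℝ≥0∞) = b * ((1 / (1 + b) : ℝ≥0) : ℝ≥0∞) := by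
    rw [← ENNReal.coe_mul, mul_one_div]
  have hbal : ∀ z w, m z * jumpRate (1 / (1 + b)) (b / (1 + b)) z w =
      m w * jumpRate (1 / (1 + b)) (b / (1 + b)) w z := by
    intro z w
    unfold jumpRate
    rw [Finset.mul_sum, Finset.mul_sum]
    refine Finset.sum_congr rfl fun j _ => ?_
    rw [mul_add, mul_add, add_comm]
    congr 1
    · split_ifs with h
      · rw [hstep j z w h, hrate]; ring
      · simp
    · split_ifs with h
      · rw [hstep j w z h, hrate]; ring
      · simp
  refine ⟨PMF.normalize m hm0 hmt, fun w => ?_⟩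
  simp only [PMF.normalize_apply]
  rw [← ENNReal.tsum_mul_left]
  refine tsum_congr fun z => ?_
  rw [mul_right_comm, hbal w z]
  ring

/-- A symmetric process has no stationary law: such a law would be constant along the jumps of
the last particle to the right. -/
theorem not_exists_stationaryLaw_one : ¬ ∃ μ : PMF (ParticleConfig n), IsStationaryLaw n 1 μ := by
  rintro ⟨μ, hμ⟩
  set a : ℝ≥0 := 1 / (1 + 1) with ha
  have ha0 : (a : ℝ≥0∞) ≠ 0 := by rw [ha]; norm_num
  have hsymm : ∀ z w : ParticleConfig n, jumpRate a a z w = jumpRate a a w z := by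
    intro z w
    unfold jumpRate
    exact Finset.sum_congr rfl fun j _ => add_comm _ _
  have hfin : ∀ c : ℝ≥0∞, c ≠ 0 → {z | c ≤ μ z}.Finite := fun c hc =>
    ENNReal.finite_const_le_of_tsum_ne_top (by rw [μ.tsum_coe]; exact ENNReal.one_ne_top) hc
  obtain ⟨z₀, hz₀⟩ := μ.support_nonempty
  have hz₀' : μ z₀ ≠ 0 := (μ.mem_support_iff z₀).1 hz₀
  -- Superlevel sets of a probability mass function are finite, so the maximal mass is attained and
  -- the maximum principle applies.
  obtain ⟨w, hw, hmax⟩ := Set.exists_max_image _ μ (hfin _ hz₀') ⟨z₀, le_refl (μ z₀)⟩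
  have hw0 : μ w ≠ 0 := (lt_of_lt_of_le (pos_iff_ne_zero.2 hz₀') hw).ne'
  have hmax' : ∀ z, μ z ≤ μ w := by
    intro z
    by_cases h : μ z₀ ≤ μ z
    · exact hmax z h
    · exact (not_le.1 h).le.trans hw
  set k : Fin n := ⟨n - 1, Nat.sub_lt n.pos one_pos⟩ with hk
  have hmove : ∀ z : ParticleConfig n, ((jumpRight k z).1 k : ℕ) = z.1 k + 1 := by
    intro z
    rcases jumpRight_cases k z with ⟨-, l, hl, -⟩ | ⟨-, -, e⟩
    · have h1 : (n : ℕ) - 1 < l := hl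
      have := l.2
      omega
    · exact e
  have hne : ∀ z : ParticleConfig n, jumpRight k z ≠ z := fun z h => by
    have := hmove z
    rw [h] at this
    omega
  have hRfin : ∀ z : ParticleConfig n, ∑' v, jumpRate a a z v ≠ ⊤ := by
    intro z
    have := tsum_jumpRate_mul a a z 1
    simp only [Pi.one_apply, mul_one] at this
    rw [this]
    refine (ENNReal.sum_lt_top.2 fun j _ => ENNReal.add_lt_top.2 ⟨?_, ?_⟩).ne <;>
      split_ifs <;> simp
  have hstep : ∀ z, μ z = μ w → μ (jumpRight k z) = μ w := by
    intro z hz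
    -- With symmetric rates, a neighbour of strictly smaller mass would make the inflow at a maximum
    -- strictly smaller than the outflow.
    by_contra hcon
    have hlt : μ (jumpRight k z) < μ w := lt_of_le_of_ne (hmax' _) hcon
    have hpos : jumpRate a a z (jumpRight k z) ≠ 0 := by
      classical
      rw [jumpRate_eq]
      intro h0
      have h1 := Finset.sum_eq_zero_iff.1 h0 k (Finset.mem_univ k)
      rw [if_pos rfl, if_neg (hne z)] at h1
      exact ha0 (add_eq_zero.1 h1).2
    have hbal : μ z * ∑' v, jumpRate a a z v = ∑' v, μ v * jumpRate a a v z := hμ z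
    rw [← ENNReal.tsum_mul_left] at hbal
    have hrt : jumpRate a a z (jumpRight k z) ≠ ⊤ := ENNReal.ne_top_of_tsum_ne_top (hRfin z) _
    refine absurd hbal (ne_of_gt ?_)
    refine ENNReal.tsum_lt_tsum (i := jumpRight k z) ?_ (fun v => ?_) ?_
    · rw [← hbal, ENNReal.tsum_mul_left]
      exact ENNReal.mul_ne_top (μ.apply_ne_top z) (hRfin z)
    · rw [hsymm v z, hz]
      gcongr
      exact hmax' v
    · rw [hsymm (jumpRight k z) z, hz]
      exact ENNReal.mul_lt_mul_left hpos hrt hlt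
  have hiter : ∀ m : ℕ, μ ((jumpRight k)^[m] w) = μ w ∧
      (((jumpRight k)^[m] w).1 k : ℕ) = w.1 k + m := by
    intro m
    induction m with
    | zero => exact ⟨rfl, rfl⟩
    | succ m ih =>
      rw [Function.iterate_succ_apply']
      refine ⟨hstep _ ih.1, ?_⟩
      rw [hmove, ih.2]; rfl
  have hinj : Function.Injective fun m : ℕ => (jumpRight k)^[m] w := by
    intro m m' h
    have h1 := (hiter m).2
    have h2 := (hiter m').2
    simp only at h
    rw [h] at h1
    omega
  exact Set.infinite_of_injective_forall_mem hinj (fun m => (hiter m).1.ge) (hfin _ hw0)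

end ParticleConfig

open ParticleConfig

/-! ### The first `i` items as particles -/

/-- The positions of the items `1, …, i`, enumerated from left to right. -/
noncomputable def itemConfig (i : ℕ+) (σ : Equiv.Perm ℕ+) : ParticleConfig i :=
  ⟨((Finset.Icc 1 i).map σ.toEmbedding).orderEmbOfFin
    (by rw [Finset.card_map, PNat.card_Icc]; simp), OrderEmbedding.strictMono _⟩

theorem range_itemConfig (i : ℕ+) (σ : Equiv.Perm ℕ+) :
    Set.range (itemConfig i σ).1 = σ '' Set.Icc 1 i := by
  simp [itemConfig, Finset.range_orderEmbOfFin]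

theorem apply_mem_range_itemConfig {i : ℕ+} {σ : Equiv.Perm ℕ+} {r : ℕ+} :
    σ r ∈ Set.range (itemConfig i σ).1 ↔ r ≤ i := by
  rw [range_itemConfig, σ.injective.mem_set_image, Set.mem_Icc]
  exact and_iff_right one_le

theorem range_itemConfig_transposeStep (i : ℕ+) (σ : Equiv.Perm ℕ+) {r : ℕ+} (h : σ r ≠ 1) :
    Set.range (itemConfig i (transposeStep σ r)).1 =
      Equiv.swap (σ r) (σ r - 1) '' Set.range (itemConfig i σ).1 := by
  rw [range_itemConfig, range_itemConfig, transposeStep, if_neg h, Set.image_image]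
  rfl

theorem itemConfig_transposeStep_of_le {i : ℕ+} (σ : Equiv.Perm ℕ+) {r : ℕ+} (h : r ≤ i) :
    ∃ k, (itemConfig i σ).1 k = σ r ∧
      itemConfig i (transposeStep σ r) = jumpLeft k (itemConfig i σ) := by
  obtain ⟨k, hk⟩ := apply_mem_range_itemConfig.2 h
  refine ⟨k, hk, ?_⟩
  by_cases h1 : σ r = 1
  · rw [transposeStep, if_pos h1]
    rcases jumpLeft_cases k (itemConfig i σ) with ⟨e, -⟩ | ⟨-, h2, -⟩
    · exact e.symm
    · exact absurd (hk.trans h1) h2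
  · refine eq_of_range_eq ?_
    rw [range_itemConfig_transposeStep i σ h1, range_jumpLeft (by rw [hk]; exact h1), hk]

theorem itemConfig_transposeStep_of_lt {i : ℕ+} (σ : Equiv.Perm ℕ+) {r : ℕ+} (h : i < r) :
    itemConfig i (transposeStep σ r) = itemConfig i σ ∨
    ∃ k, (itemConfig i σ).1 k + 1 = σ r ∧
      itemConfig i (transposeStep σ r) = jumpRight k (itemConfig i σ) := by
  by_cases h1 : σ r = 1
  · left; rw [transposeStep, if_pos h1]
  have hr : σ r ∉ Set.range (itemConfig i σ).1 := fun h' =>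
    absurd (apply_mem_range_itemConfig.1 h') (not_le.2 h)
  by_cases h2 : σ r - 1 ∈ Set.range (itemConfig i σ).1
  · right
    obtain ⟨k, hk⟩ := h2
    have h3 : (itemConfig i σ).1 k + 1 = σ r := by
      refine PNat.eq ?_
      have := (σ r).pos
      have h1' : (σ r : ℕ) ≠ 1 := by simpa using h1
      rw [hk, PNat.add_coe, coe_sub_one h1, PNat.one_coe]
      omega
    refine ⟨k, h3, eq_of_range_eq ?_⟩
    rw [range_itemConfig_transposeStep i σ h1, range_jumpRight, h3, hk, Equiv.swap_comm]
  · left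
    refine eq_of_range_eq ?_
    rw [range_itemConfig_transposeStep i σ h1, swap_image_of_mem (iff_of_false hr h2)]

/-! ### The request operator and its comparison with the generator -/

/-- The expectation of `u` after one request, as a function of the current list. -/
noncomputable def requestStep (π : ℕ+ → ℝ≥0) (u : Equiv.Perm ℕ+ → ℝ) (σ : Equiv.Perm ℕ+) : ℝ :=
  ∑' r, (π r : ℝ) * u (transposeStep σ r)

/-- After one request, `u` takes values in a bounded set which may depend on the current list. -/
def StepBounded (u : Equiv.Perm ℕ+ → ℝ) : Prop :=
  ∀ σ, ∃ B, ∀ r, |u (transposeStep σ r)| ≤ B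

theorem StepBounded.summable {u : Equiv.Perm ℕ+ → ℝ} (hu : StepBounded u)
    {π : ℕ+ → ℝ≥0} (hsum : HasSum π 1) (σ : Equiv.Perm ℕ+) :
    Summable fun r => (π r : ℝ) * u (transposeStep σ r) := by
  obtain ⟨B, hB⟩ := hu σ
  have h1 : Summable fun r => (π r : ℝ) := NNReal.summable_coe.2 hsum.summable
  refine Summable.of_norm_bounded (h1.mul_right B) fun r => ?_
  rw [norm_mul, Real.norm_eq_abs, Real.norm_eq_abs, NNReal.abs_eq]
  exact mul_le_mul_of_nonneg_left (hB r) (π r).coe_nonneg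

theorem tsum_coe_request {π : ℕ+ → ℝ≥0} (hsum : HasSum π 1) : ∑' r, (π r : ℝ) = 1 := by
  have : HasSum (fun r => (π r : ℝ)) ((1 : ℝ≥0) : ℝ) := NNReal.hasSum_coe.2 hsum
  simpa using this.tsum_eq

theorem requestStep_le_requestStep {π : ℕ+ → ℝ≥0} (hsum : HasSum π 1) {u v : Equiv.Perm ℕ+ → ℝ}
    (hu : StepBounded u) (hv : StepBounded v) {σ : Equiv.Perm ℕ+}
    (h : ∀ r, u (transposeStep σ r) ≤ v (transposeStep σ r)) :
    requestStep π u σ ≤ requestStep π v σ :=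
  (hu.summable hsum σ).tsum_le_tsum
    (fun r => mul_le_mul_of_nonneg_left (h r) (π r).coe_nonneg) (hv.summable hsum σ)

/-- If item `r` is at the front, then with probability at least `π r` the list does not change. -/
theorem requestStep_le_sub {π : ℕ+ → ℝ≥0} (hsum : HasSum π 1) {u v : Equiv.Perm ℕ+ → ℝ}
    (hu : StepBounded u) (hv : StepBounded v)
    (h : ∀ σ, u σ ≤ v σ) {σ : Equiv.Perm ℕ+} {r : ℕ+} (hr : σ r = 1) :
    requestStep π u σ ≤ requestStep π v σ - π r * (v σ - u σ) := by
  have hs := (hv.summable hsum σ).sub (hu.summable hsum σ)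
  have h1 := hs.le_tsum r fun r' _ => sub_nonneg.2
    (mul_le_mul_of_nonneg_left (h (transposeStep σ r')) (π r').coe_nonneg)
  rw [(hv.summable hsum σ).tsum_sub (hu.summable hsum σ)] at h1
  have h2 : transposeStep σ r = σ := by rw [transposeStep, if_pos hr]
  rw [h2] at h1
  unfold requestStep
  linarith

theorem requestStep_const_add {π : ℕ+ → ℝ≥0} (hsum : HasSum π 1) {u : Equiv.Perm ℕ+ → ℝ}
    (hu : StepBounded u) (a : ℝ)
    (σ : Equiv.Perm ℕ+) : requestStep π (fun σ => a + u σ) σ = a + requestStep π u σ := by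
  have h1 : Summable fun r => (π r : ℝ) := NNReal.summable_coe.2 hsum.summable
  unfold requestStep
  simp only [mul_add]
  rw [(h1.mul_right a).tsum_add (hu.summable hsum σ), tsum_mul_right, tsum_coe_request hsum,
    one_mul]

theorem requestStep_const_mul (π : ℕ+ → ℝ≥0) (u : Equiv.Perm ℕ+ → ℝ) (a : ℝ)
    (σ : Equiv.Perm ℕ+) : requestStep π (fun σ => a * u σ) σ = a * requestStep π u σ := by
  unfold requestStep
  rw [← tsum_mul_left]
  exact tsum_congr fun r => by ring

theorem StepBounded.of_mem_Icc {u : Equiv.Perm ℕ+ → ℝ} {a b : ℝ} (h : ∀ σ, u σ ∈ Set.Icc a b) :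
    StepBounded u := fun _ => ⟨max |a| |b|, fun _ => abs_le_max_abs_abs (h _).1 (h _).2⟩

theorem StepBounded.const_add {u : Equiv.Perm ℕ+ → ℝ} (hu : StepBounded u) (a : ℝ) :
    StepBounded fun σ => a + u σ := fun σ => by
  obtain ⟨B, hB⟩ := hu σ
  exact ⟨|a| + B, fun r => (abs_add_le _ _).trans (add_le_add_right (hB r) _)⟩

theorem StepBounded.const_mul {u : Equiv.Perm ℕ+ → ℝ} (hu : StepBounded u) (a : ℝ) :
    StepBounded fun σ => a * u σ := fun σ => by
  obtain ⟨B, hB⟩ := hu σ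
  refine ⟨|a| * B, fun r => ?_⟩
  rw [abs_mul]
  exact mul_le_mul_of_nonneg_left (hB r) (abs_nonneg a)

/-- One request leads to only finitely many particle configurations. This makes the expectation of
the unbounded Lyapunov function a convergent series. -/
theorem StepBounded.itemConfig (i : ℕ+) (f : ParticleConfig i → ℝ) :
    StepBounded fun σ => f (itemConfig i σ) := by
  intro σ
  set z := _root_.itemConfig i σ with hz
  set L := ∑ k, |f (jumpLeft k z)| with hL
  set R := ∑ k, |f (jumpRight k z)| with hR
  have hL0 : 0 ≤ L := Finset.sum_nonneg fun _ _ => abs_nonneg _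
  have hR0 : 0 ≤ R := Finset.sum_nonneg fun _ _ => abs_nonneg _
  have h0 := abs_nonneg (f z)
  refine ⟨|f z| + (L + R), fun r => ?_⟩
  simp only
  rcases le_or_gt r i with h | h
  · obtain ⟨k, -, e⟩ := itemConfig_transposeStep_of_le σ h
    rw [e]
    have : |f (jumpLeft k z)| ≤ L :=
      Finset.single_le_sum (f := fun k => |f (jumpLeft k z)|) (fun _ _ => abs_nonneg _)
        (Finset.mem_univ k)
    linarith
  · rcases itemConfig_transposeStep_of_lt σ h with e | ⟨k, -, e⟩
    · rw [e]; linarith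
    · rw [e]
      have : |f (jumpRight k z)| ≤ R :=
        Finset.single_le_sum (f := fun k => |f (jumpRight k z)|) (fun _ _ => abs_nonneg _)
          (Finset.mem_univ k)
      linarith

/-- The positions of the first `i` items move to the left at least as fast, and to the right at
most as fast, as the particles of the exclusion process. -/
theorem requestStep_itemConfig_le {π : ℕ+ → ℝ≥0} (hsum : HasSum π 1) (hmono : Antitone π) {i : ℕ+}
    {f : ParticleConfig i → ℝ} (hf : Monotone f) (σ : Equiv.Perm ℕ+) :
    requestStep π (fun σ => f (itemConfig i σ)) σ ≤
      f (itemConfig i σ) + drift (π i) (π (i + 1)) f (itemConfig i σ) := by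
  set z := itemConfig i σ with hz
  set a : Fin i → ℝ := fun k => π i * (f (jumpLeft k z) - f z) with ha
  set b : Fin i → ℝ := fun k => π (i + 1) * (f (jumpRight k z) - f z) with hb
  have ha0 : ∀ k, f (jumpLeft k z) - f z ≤ 0 := fun k => sub_nonpos.2 (hf (jumpLeft_le k z))
  have hb0 : ∀ k, 0 ≤ f (jumpRight k z) - f z := fun k => sub_nonneg.2 (hf (le_jumpRight k z))
  have hb0' : ∀ k, 0 ≤ b k := fun k => mul_nonneg (π (i + 1)).coe_nonneg (hb0 k)
  -- The drift is distributed over the items: the left term of particle `k` is charged to the item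
  -- in its slot, the right term to the item directly behind it.
  set G : ℕ+ → ℝ := fun r =>
    ∑ k, ((if r = σ.symm (z.1 k) then a k else 0) +
      (if r = σ.symm (z.1 k + 1) then b k else 0)) with hG
  have hGsum : HasSum G (drift (π i) (π (i + 1)) f z) :=
    hasSum_sum fun k _ => (hasSum_ite_eq _ _).add (hasSum_ite_eq _ _)
  have hu := StepBounded.itemConfig i f
  have hs := (hu.const_add (-f z)).summable hsum σ
  have hle : ∀ r, (π r : ℝ) * (-f z + f (itemConfig i (transposeStep σ r))) ≤ G r := by
    intro r
    rcases le_or_gt r i with h | h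
    · obtain ⟨k, hk, e⟩ := itemConfig_transposeStep_of_le σ h
      rw [e, neg_add_eq_sub]
      have h1 : ∑ l, (if r = σ.symm (z.1 l) then a l else 0) = a k := by
        rw [Finset.sum_eq_single k]
        · rw [if_pos]; rw [hz, hk, Equiv.symm_apply_apply]
        · intro l _ hl
          rw [if_neg]
          rintro rfl
          rw [Equiv.apply_symm_apply] at hk
          exact hl (z.2.injective hk.symm)
        · simp
      have h2 : 0 ≤ ∑ l, (if r = σ.symm (z.1 l + 1) then b l else 0) :=
        Finset.sum_nonneg fun l _ => by split_ifs; exacts [hb0' l, le_rfl]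
      have h3 : (π r : ℝ) * (f (jumpLeft k z) - f z) ≤ a k :=
        mul_le_mul_of_nonpos_right (by exact_mod_cast hmono h) (ha0 k)
      simp only [hG]
      rw [Finset.sum_add_distrib, h1]
      linarith
    · have h1 : ∑ l, (if r = σ.symm (z.1 l) then a l else 0) = 0 := by
        refine Finset.sum_eq_zero fun l _ => ?_
        rw [if_neg]
        intro e
        refine absurd (apply_mem_range_itemConfig (i := i) (σ := σ) (r := r)|>.1 ?_) (not_le.2 h)
        rw [e, Equiv.apply_symm_apply]
        exact ⟨l, rfl⟩
      have h2 : ∀ l ∈ Finset.univ, 0 ≤ (if r = σ.symm (z.1 l + 1) then b l else 0) :=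
        fun l _ => by split_ifs; exacts [hb0' l, le_rfl]
      simp only [hG]
      rw [Finset.sum_add_distrib, h1, zero_add]
      rcases itemConfig_transposeStep_of_lt σ h with e | ⟨k, hk, e⟩
      · rw [e, neg_add_cancel, mul_zero]
        exact Finset.sum_nonneg h2
      · rw [e, neg_add_eq_sub]
        refine le_trans ?_ (Finset.single_le_sum h2 (Finset.mem_univ k))
        rw [if_pos (by rw [hz, hk, Equiv.symm_apply_apply])]
        exact mul_le_mul_of_nonneg_right (by exact_mod_cast hmono (PNat.add_one_le_iff.2 h)) (hb0 k)
  have h1 := hs.tsum_le_tsum hle hGsum.summable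
  rw [hGsum.tsum_eq] at h1
  have h2 := requestStep_const_add hsum hu (-f z) σ
  unfold requestStep at h2 ⊢
  linarith

/-! ### Lazy requests and domination by the exclusion process -/

/-- With probability `δ` an item is requested, otherwise the list is left alone. -/
noncomputable def lazyRequest (π : ℕ+ → ℝ≥0) (δ : ℝ) (u : Equiv.Perm ℕ+ → ℝ)
    (σ : Equiv.Perm ℕ+) : ℝ :=
  u σ + δ * (requestStep π u σ - u σ)

theorem requestStep_mem_Icc {π : ℕ+ → ℝ≥0} (hsum : HasSum π 1) {u : Equiv.Perm ℕ+ → ℝ}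
    (hu : ∀ σ, u σ ∈ Set.Icc (0 : ℝ) 1) (σ : Equiv.Perm ℕ+) :
    requestStep π u σ ∈ Set.Icc (0 : ℝ) 1 := by
  refine ⟨tsum_nonneg fun r => mul_nonneg (π r).coe_nonneg (hu _).1, ?_⟩
  rw [← tsum_coe_request hsum]
  exact ((StepBounded.of_mem_Icc hu).summable hsum σ).tsum_le_tsum
    (fun r => mul_le_of_le_one_right (π r).coe_nonneg (hu _).2)
    (NNReal.summable_coe.2 hsum.summable)

theorem lazyRequest_mem_Icc {π : ℕ+ → ℝ≥0} (hsum : HasSum π 1) {δ : ℝ} (hδ0 : 0 ≤ δ) (hδ1 : δ ≤ 1)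
    {u : Equiv.Perm ℕ+ → ℝ} (hu : ∀ σ, u σ ∈ Set.Icc (0 : ℝ) 1) (σ : Equiv.Perm ℕ+) :
    lazyRequest π δ u σ ∈ Set.Icc (0 : ℝ) 1 := by
  obtain ⟨h1, h2⟩ := requestStep_mem_Icc hsum hu σ
  obtain ⟨h3, h4⟩ := hu σ
  unfold lazyRequest
  constructor <;> nlinarith

theorem requestStep_lazyRequest {π : ℕ+ → ℝ≥0} (hsum : HasSum π 1) (δ : ℝ)
    {u : Equiv.Perm ℕ+ → ℝ} (hu : ∀ σ, u σ ∈ Set.Icc (0 : ℝ) 1) :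
    requestStep π (lazyRequest π δ u) = lazyRequest π δ (requestStep π u) := by
  funext σ
  have h1 := (StepBounded.of_mem_Icc hu).summable hsum σ
  have h2 := (StepBounded.of_mem_Icc (requestStep_mem_Icc hsum hu)).summable hsum σ
  have h3 : ∀ r, (π r : ℝ) * lazyRequest π δ u (transposeStep σ r) =
      π r * u (transposeStep σ r) + δ * (π r * requestStep π u (transposeStep σ r) -
        π r * u (transposeStep σ r)) := fun r => by unfold lazyRequest; ring
  rw [requestStep, tsum_congr h3, h1.tsum_add ((h2.sub h1).mul_left δ), tsum_mul_left,
    h2.tsum_sub h1]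
  rfl

theorem iterate_lazyRequest_mem_Icc {π : ℕ+ → ℝ≥0} (hsum : HasSum π 1) {δ : ℝ} (hδ0 : 0 ≤ δ)
    (hδ1 : δ ≤ 1) {u : Equiv.Perm ℕ+ → ℝ} (hu : ∀ σ, u σ ∈ Set.Icc (0 : ℝ) 1) (j : ℕ) :
    ∀ σ, (lazyRequest π δ)^[j] u σ ∈ Set.Icc (0 : ℝ) 1 := by
  induction j with
  | zero => exact hu
  | succ j ih =>
    rw [Function.iterate_succ_apply']
    exact lazyRequest_mem_Icc hsum hδ0 hδ1 ih

theorem iterate_requestStep_mem_Icc {π : ℕ+ → ℝ≥0} (hsum : HasSum π 1)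
    {u : Equiv.Perm ℕ+ → ℝ} (hu : ∀ σ, u σ ∈ Set.Icc (0 : ℝ) 1) (m : ℕ) :
    ∀ σ, (requestStep π)^[m] u σ ∈ Set.Icc (0 : ℝ) 1 := by
  induction m with
  | zero => exact hu
  | succ m ih =>
    rw [Function.iterate_succ_apply']
    exact requestStep_mem_Icc hsum ih

theorem iterate_requestStep_lazyRequest {π : ℕ+ → ℝ≥0} (hsum : HasSum π 1) (δ : ℝ)
    {u : Equiv.Perm ℕ+ → ℝ} (hu : ∀ σ, u σ ∈ Set.Icc (0 : ℝ) 1) (m : ℕ) :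
    (requestStep π)^[m] (lazyRequest π δ u) = lazyRequest π δ ((requestStep π)^[m] u) := by
  induction m with
  | zero => rfl
  | succ m ih =>
    rw [Function.iterate_succ_apply', Function.iterate_succ_apply', ih,
      requestStep_lazyRequest hsum δ (iterate_requestStep_mem_Icc hsum hu m)]

theorem iterate_lazyRequest_itemConfig_le {π : ℕ+ → ℝ≥0} (hsum : HasSum π 1)
    (hmono : Antitone π) {i : ℕ+} {δ : ℝ} (hδ0 : 0 ≤ δ) (hδ1 : δ ≤ 1)
    (h : δ * (i * ((π i : ℝ) + π (i + 1))) ≤ 1) {g : ParticleConfig i → ℝ} (hg : Monotone g)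
    (hg01 : ∀ z, g z ∈ Set.Icc (0 : ℝ) 1) (j : ℕ) (σ : Equiv.Perm ℕ+) :
    (lazyRequest π δ)^[j] (fun σ => g (itemConfig i σ)) σ ≤
      (lazyStep δ (π i) (π (i + 1)))^[j] g (itemConfig i σ) := by
  induction j generalizing σ with
  | zero => exact le_rfl
  | succ j ih =>
    rw [Function.iterate_succ_apply', Function.iterate_succ_apply']
    set f := (lazyStep δ (π i) (π (i + 1)))^[j] g with hf
    -- The one-step comparison holds for increasing functions only; here the smallness of `δ` is
    -- indispensable to the argument.
    have hfm : Monotone f :=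
      iterate_lazyStep_monotone hδ0 (π i).coe_nonneg (π (i + 1)).coe_nonneg h hg j
    have h1 := requestStep_itemConfig_le hsum hmono hfm σ
    have h2 := requestStep_le_requestStep hsum (StepBounded.of_mem_Icc
      (iterate_lazyRequest_mem_Icc hsum hδ0 hδ1 (fun σ => hg01 (itemConfig i σ)) j))
      (StepBounded.itemConfig i f) (σ := σ) (fun r => ih _)
    have h3 := ih σ
    have h4 := mul_le_mul_of_nonneg_left (h2.trans h1) hδ0
    have h5 := mul_le_mul_of_nonneg_left h3 (sub_nonneg.2 hδ1)
    rw [lazyRequest, lazyStep]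
    linarith

/-! ### From lazy requests to actual requests -/

/-- The gain from staying put, with probability at least `p`, in each of two consecutive steps. -/
theorem two_step_estimate {p p' c t A E F δ ε a b d : ℝ} (hp0 : 0 < p) (hp1 : p ≤ 1) (hp' : p ≤ p')
    (ht : 0 ≤ t) (hE : 0 ≤ E) (hδ0 : 0 ≤ δ) (hδ1 : δ ≤ 1) (ha : a ≤ c + t * (A + F))
    (hb : b ≤ c + t * (A + E + F)) (hab : b ≤ c + t * (A + E + F) - p' * (c + t * (A + F) - a))
    (hd : d ≤ c + t * (A + 2 * E + F) - p' * (c + t * (A + E + F) - b))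
    (hδ : a + δ * (b - a) ≤ c + t * (1 - δ * ε) * (A + F)) :
    d ≤ c + t * (A + 2 * E + F - p ^ 2 * (δ * ε) * (A + F)) := by
  set B := c + t * (A + F) with hB
  set B' := c + t * (A + E + F) with hB'
  have hBB' : B ≤ B' := by
    have := mul_nonneg ht hE
    rw [hB, hB']; linarith
  have h8 : p * (B - a) ≤ B' - b := by
    have := mul_le_mul_of_nonneg_right hp' (sub_nonneg.2 ha)
    linarith
  -- The deficit on the left is the mixture `(1 - δ) * (B - a) + δ * (B - b)`. The first part is
  -- controlled by `h8`, the second by `B ≤ B'` and `p ≤ 1`.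
  have h9 : p * (B - (a + δ * (b - a))) ≤ B' - b := by
    have e1 := mul_le_mul_of_nonneg_left h8 (sub_nonneg.2 hδ1)
    have e2 := mul_le_mul_of_nonneg_right hp1 (sub_nonneg.2 hb)
    have e3 := mul_le_mul_of_nonneg_left hBB' hp0.le
    have e4 : δ * (p * (B - b)) ≤ δ * (B' - b) :=
      mul_le_mul_of_nonneg_left (by linarith) hδ0
    linarith
  have h10 : t * (δ * ε) * (A + F) ≤ B - (a + δ * (b - a)) := by
    rw [hB]; linarith
  have h11 := mul_le_mul_of_nonneg_left (mul_le_mul_of_nonneg_left h10 hp0.le) hp0.le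
  have h12 := mul_le_mul_of_nonneg_left h9 hp0.le
  have h13 := mul_le_mul_of_nonneg_right hp' (sub_nonneg.2 hb)
  have h14 : p * (p * (t * (δ * ε) * (A + F))) = t * (p ^ 2 * (δ * ε) * (A + F)) := by ring
  linarith

set_option maxHeartbeats 1000000 in
/-- The law of the list approaches the stationary bound `c` at an exponential rate. -/
theorem exists_iterate_requestStep_le {π : ℕ+ → ℝ≥0} (hsum : HasSum π 1) (hmono : Antitone π)
    {i : ℕ+} (hi : π (i + 1) < π i) {δ : ℝ} (hδ0 : 0 < δ) (hδ1 : δ ≤ 1)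
    (hδ : δ * (i * ((π i : ℝ) + π (i + 1))) ≤ 1) {g : ParticleConfig i → ℝ} (hg : Monotone g)
    (hg01 : ∀ z, g z ∈ Set.Icc (0 : ℝ) 1) {c : ℝ}
    (hc : ∀ j, (lazyStep δ (π i) (π (i + 1)))^[j] g (packed i) ≤ c) (σ : Equiv.Perm ℕ+) :
    ∃ ρ M : ℝ, 0 ≤ ρ ∧ ρ < 1 ∧
      ∀ m, (requestStep π)^[m] (fun σ => g (itemConfig i σ)) σ ≤ c + M * ρ ^ m := by
  set p : ℝ := (π i : ℝ) with hp
  set q : ℝ := (π (i + 1) : ℝ) with hq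
  have hq0 : 0 ≤ q := (π (i + 1)).coe_nonneg
  have hqp : q < p := by exact_mod_cast hi
  have hp0 : 0 < p := hq0.trans_lt hqp
  have hp1 : p ≤ 1 := by
    have := (NNReal.summable_coe.2 hsum.summable).le_tsum i fun r _ => (π r).coe_nonneg
    rwa [tsum_coe_request hsum] at this
  obtain ⟨Φ, hΦm, hΦ1, ε₀, hε₀, hΦ₀⟩ := exists_lyapunov (n := i) hq0 hqp
  set ε : ℝ := min ε₀ 1 with hε
  have hε0 : 0 < ε := lt_min hε₀ one_pos
  have hε1 : ε ≤ 1 := min_le_right _ _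
  have hΦ : ∀ z, z ≠ packed i → drift p q Φ z ≤ -(ε * Φ z) := fun z hz =>
    (hΦ₀ z hz).trans (neg_le_neg (mul_le_mul_of_nonneg_right (min_le_left _ _)
      (zero_le_one.trans (hΦ1 z))))
  have hδε : δ * ε ≤ 1 := mul_le_one₀ hδ1 hε0.le hε1
  have hδε0 : 0 < δ * ε := mul_pos hδ0 hε0
  set s : ℝ := 1 - δ * ε with hs
  have hs0 : 0 ≤ s := by linarith
  set E : ℝ := max 0 (drift p q Φ (packed i)) with hE
  have hE0 : 0 ≤ E := le_max_left _ _
  have hTΦ : ∀ σ, requestStep π (fun σ => Φ (itemConfig i σ)) σ ≤ Φ (itemConfig i σ) + E := by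
    intro σ
    refine (requestStep_itemConfig_le hsum hmono hΦm σ).trans (add_le_add_right ?_ _)
    by_cases h : itemConfig i σ = packed i
    · rw [h]; exact le_max_right _ _
    · have := mul_pos hε0 (zero_lt_one.trans_le (hΦ1 (itemConfig i σ)))
      exact (hΦ _ h).trans (by linarith)
  have hTΦ' : ∀ σ, itemConfig i σ ≠ packed i →
      requestStep π (fun σ => Φ (itemConfig i σ)) σ ≤ (1 - ε) * Φ (itemConfig i σ) := by
    intro σ h
    have h1 := requestStep_itemConfig_le hsum hmono hΦm σ
    have h2 := hΦ _ h
    linarith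
  set κ : ℝ := p ^ 2 * (δ * ε) with hκ
  have hκ0 : 0 < κ := by positivity
  -- Then the growth `2 * E` of the bound over two steps is half of `κ * A`, so a gain of `κ * (A +
  -- F)` absorbs it.
  set A : ℝ := 4 * E / κ with hA
  have hA0 : 0 ≤ A := by positivity
  have hκA : κ * A = 4 * E := by rw [hA]; field_simp
  -- The three bounds give `ρ > 0`, contraction by `ρ` off the packed configuration (where `Φ ≥ 1`
  -- is used), and `1 - κ / 2 ≤ ρ ^ 2` for the two steps at it.
  set x : ℝ := min (1 / 2) (min (ε / (A + 1)) (κ / 4)) with hx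
  have hx0 : 0 < x := lt_min (by norm_num) (lt_min (by positivity) (by positivity))
  have hx1 : x ≤ 1 / 2 := min_le_left _ _
  have hxA : x * (A + 1) ≤ ε := by
    rw [← le_div_iff₀ (by positivity)]
    exact (min_le_right _ _).trans (min_le_left _ _)
  have hxκ : x ≤ κ / 4 := (min_le_right _ _).trans (min_le_right _ _)
  set ρ : ℝ := 1 - x with hρ
  have hρ0 : 0 < ρ := by linarith
  have hρ1 : ρ < 1 := by linarith
  -- Large enough for the start of the induction at `m = 1`, where one step may raise `Φ` by `E`.
  set M : ℝ := (1 + E) / ρ with hM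
  have hMρ : M * ρ = 1 + E := by rw [hM]; field_simp
  have hM0 : 0 < M := by positivity
  have hM1 : 1 ≤ M := by rw [hM, le_div_iff₀ hρ0]; linarith
  set G : Equiv.Perm ℕ+ → ℝ := fun σ => g (itemConfig i σ) with hG
  have hG01 : ∀ σ, G σ ∈ Set.Icc (0 : ℝ) 1 := fun σ => hg01 _
  set u : ℕ → ℕ → Equiv.Perm ℕ+ → ℝ := fun m j =>
    (requestStep π)^[m] ((lazyRequest π δ)^[j] G) with hu
  have hu01 : ∀ m j σ, u m j σ ∈ Set.Icc (0 : ℝ) 1 := fun m j =>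
    iterate_requestStep_mem_Icc hsum (iterate_lazyRequest_mem_Icc hsum hδ0.le hδ1 hG01 j) m
  have hub : ∀ m j, StepBounded (u m j) := fun m j => StepBounded.of_mem_Icc (hu01 m j)
  have husucc : ∀ m j, u (m + 1) j = requestStep π (u m j) := fun m j =>
    Function.iterate_succ_apply' _ _ _
  have hulazy : ∀ m j, u m (j + 1) = lazyRequest π δ (u m j) := by
    intro m j
    simp only [hu]
    rw [Function.iterate_succ_apply', iterate_requestStep_lazyRequest hsum δ
      (iterate_lazyRequest_mem_Icc hsum hδ0.le hδ1 hG01 j)]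
  have hbd : ∀ t a : ℝ, StepBounded fun σ => (c + t * a) + t * Φ (itemConfig i σ) := fun t a =>
    ((StepBounded.itemConfig i Φ).const_mul t).const_add _
  have hTbd : ∀ t a : ℝ, ∀ σ, requestStep π (fun σ => (c + t * a) + t * Φ (itemConfig i σ)) σ =
      (c + t * a) + t * requestStep π (fun σ => Φ (itemConfig i σ)) σ := by
    intro t a σ
    rw [requestStep_const_add hsum ((StepBounded.itemConfig i Φ).const_mul t) (c + t * a) σ,
      requestStep_const_mul]
  have hu0 : ∀ j σ, u 0 j σ ≤ c + s ^ j * Φ (itemConfig i σ) := by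
    intro j σ
    refine (iterate_lazyRequest_itemConfig_le hsum hmono hδ0.le hδ1 hδ hg hg01 j σ).trans ?_
    refine (iterate_lazyStep_le hδ0.le hp0.le hq0 hδ hδε hΦ1 hΦ hg (fun z => (hg01 z).1)
      (fun z => (hg01 z).2) j _).trans ?_
    exact add_le_add_left (hc j) _
  have main : ∀ m, (∀ j σ, u m j σ ≤ (c + s ^ j * ρ ^ m * M * A) +
      s ^ j * ρ ^ m * M * Φ (itemConfig i σ)) ∧
      (∀ j σ, u (m + 1) j σ ≤ (c + s ^ j * ρ ^ (m + 1) * M * A) +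
      s ^ j * ρ ^ (m + 1) * M * Φ (itemConfig i σ)) := by
    intro m
    induction m with
    | zero =>
      have hΦ0 : ∀ σ, 0 ≤ Φ (itemConfig i σ) := fun σ => zero_le_one.trans (hΦ1 _)
      constructor
      · intro j σ
        have h1 : 0 ≤ s ^ j := pow_nonneg hs0 j
        have h2 : 0 ≤ s ^ j * M * A := by positivity
        have h3 : s ^ j * Φ (itemConfig i σ) ≤ s ^ j * M * Φ (itemConfig i σ) := by
          rw [mul_assoc]
          gcongr
          exact le_mul_of_one_le_left (hΦ0 σ) hM1
        rw [pow_zero, mul_one]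
        linarith [hu0 j σ]
      · intro j σ
        have h1 : 0 ≤ s ^ j := pow_nonneg hs0 j
        have h2 := requestStep_le_requestStep hsum (hub 0 j) (hbd (s ^ j) 0) (σ := σ)
          (fun r => by rw [mul_zero, add_zero]; exact hu0 j _)
        rw [hTbd, mul_zero, add_zero, ← husucc] at h2
        have h3 := mul_le_mul_of_nonneg_left (hTΦ σ) h1
        have h4 : Φ (itemConfig i σ) + E ≤ (1 + E) * Φ (itemConfig i σ) := by
          nlinarith [hΦ1 (itemConfig i σ)]
        have h5 := mul_le_mul_of_nonneg_left h4 h1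
        have h6 : 0 ≤ s ^ j * (1 + E) * A := by positivity
        have h7 : s ^ j * ρ ^ (0 + 1) * M = s ^ j * (1 + E) := by
          rw [← hMρ]; ring
        rw [h7]
        linarith
    | succ m ih =>
      refine ⟨ih.2, fun j σ => ?_⟩
      obtain ⟨ih1, ih2⟩ := ih
      set z := itemConfig i σ with hz
      have hΦz := hΦ1 z
      by_cases hzp : z = packed i
      · set t : ℝ := s ^ j * ρ ^ m * M with ht
        have ht0 : 0 ≤ t := by positivity
        obtain ⟨r, hr⟩ : ∃ r, σ r = 1 := ⟨σ.symm 1, σ.apply_symm_apply 1⟩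
        have hri : r ≤ i := by
          rw [← apply_mem_range_itemConfig (σ := σ), hr, ← hz, hzp]
          exact ⟨⟨0, i.pos⟩, rfl⟩
        have hπr : p ≤ π r := by exact_mod_cast hmono hri
        have hBle : ∀ σ, u (m + 1) j σ ≤ (c + t * (A + E)) + t * Φ (itemConfig i σ) := by
          intro σ
          have h1 := requestStep_le_requestStep hsum (hub m j) (hbd t A) (σ := σ)
            (fun r => ih1 j _)
          rw [hTbd, ← husucc] at h1
          have h2 := mul_le_mul_of_nonneg_left (hTΦ σ) ht0
          linarith
        have h1 := requestStep_le_sub hsum (hub m j) (hbd t A) (ih1 j) hr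
        have h2 := requestStep_le_sub hsum (hub (m + 1) j) (hbd t (A + E)) hBle hr
        rw [hTbd, ← husucc] at h1 h2
        have h3 := mul_le_mul_of_nonneg_left (hTΦ σ) ht0
        -- Here `j + 1` enters: `a + δ * (b - a)` obeys a bound with the additional factor `s < 1`,
        -- so `a` and `b` cannot both be close to the bound for `j`.
        have h4 := ih1 (j + 1) σ
        rw [hulazy, lazyRequest, ← husucc] at h4
        have h5 : s ^ (j + 1) * ρ ^ m * M = t * s := by rw [ht, pow_succ]; ring
        rw [h5] at h4
        have h6 := ih1 j σ
        have h7 := hBle σ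
        simp only [← hz] at h1 h2 h3 h4 h6 h7
        rw [← ht] at h6
        set a := u m j σ with ha
        set b := u (m + 1) j σ with hb
        set F := Φ z with hF
        have h13 : u (m + 1 + 1) j σ ≤ c + t * (A + 2 * E + F - κ * (A + F)) :=
          two_step_estimate (a := a) (b := b) hp0 hp1 hπr ht0 hE0 hδ0.le hδ1 (by linarith)
            (by linarith) (by linarith) (by linarith) (by linarith)
        have h14 : A + 2 * E + F - κ * (A + F) ≤ ρ ^ 2 * (A + F) := by
          have hAF : 0 ≤ A + F := by linarith
          have e1 : 1 - κ / 2 ≤ ρ ^ 2 := by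
            have e0 : ρ ^ 2 = 1 - 2 * x + x ^ 2 := by rw [hρ]; ring
            rw [e0]; linarith [sq_nonneg x]
          have e2 := mul_le_mul_of_nonneg_right e1 hAF
          have e3 : 0 ≤ κ * F := mul_nonneg hκ0.le (by linarith)
          linarith
        have h15 := mul_le_mul_of_nonneg_left h14 ht0
        have h16 : s ^ j * ρ ^ (m + 1 + 1) * M = t * ρ ^ 2 := by rw [ht]; ring
        rw [h16]
        linarith
      · set t : ℝ := s ^ j * ρ ^ (m + 1) * M with ht
        have ht0 : 0 ≤ t := by positivity
        have h1 := requestStep_le_requestStep hsum (hub (m + 1) j) (hbd t A) (σ := σ)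
          (fun r => ih2 j _)
        rw [hTbd, ← husucc] at h1
        have h2 := mul_le_mul_of_nonneg_left (hTΦ' σ hzp) ht0
        have h3 : A + (1 - ε) * Φ z ≤ ρ * (A + Φ z) := by
          have e1 := mul_le_mul_of_nonneg_right hxA (by linarith : 0 ≤ Φ z)
          have e2 : x * (A + Φ z) ≤ x * (A + 1) * Φ z := by
            rw [mul_assoc]
            gcongr
            nlinarith
          rw [hρ]; linarith
        have h4 := mul_le_mul_of_nonneg_left h3 ht0
        have h5 : s ^ j * ρ ^ (m + 1 + 1) * M = t * ρ := by rw [ht, pow_succ ρ (m + 1)]; ring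
        rw [h5]
        linarith
  refine ⟨ρ, M * (A + Φ (itemConfig i σ)), hρ0.le, hρ1, fun m => ?_⟩
  have := (main m).1 0 σ
  rw [pow_zero, one_mul] at this
  change (requestStep π)^[m] G σ ≤ _ at this
  linarith

/-! ### Expectations of the random list -/

theorem listPos_congr {r r' : ℕ → ℕ+} {t : ℕ} (h : ∀ s < t, r s = r' s) :
    listPos r t = listPos r' t := by
  induction t with
  | zero => rfl
  | succ t ih =>
    rw [listPos, listPos, ih fun s hs => h s (hs.trans (Nat.lt_succ_self t)),
      h t (Nat.lt_succ_self t)]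

section

variable {Ω : Type*} [MeasurableSpace Ω] {P : Measure Ω} {R : ℕ → Ω → ℕ+}

/-- Every function of the list at time `t` is a measurable function of the first `t` requests. -/
theorem exists_listPos_factor (F : Equiv.Perm ℕ+ → ℝ≥0∞) (t : ℕ) :
    ∃ H : (Finset.range t → ℕ+) → ℝ≥0∞, Measurable H ∧
      ∀ r : ℕ → ℕ+, F (listPos r t) = H fun s => r s := by
  refine ⟨fun x => F (listPos (fun s => if h : s ∈ Finset.range t then x ⟨s, h⟩ else 1) t),
    measurable_of_countable _, fun r => ?_⟩
  simp only
  congr 1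
  refine listPos_congr fun s hs => ?_
  rw [dif_pos (Finset.mem_range.2 hs)]

theorem measurable_listPos (hmeas : ∀ t, Measurable (R t)) (F : Equiv.Perm ℕ+ → ℝ≥0∞) (t : ℕ) :
    Measurable fun ω => F (listPos (fun s => R s ω) t) := by
  obtain ⟨H, hH, e⟩ := exists_listPos_factor F t
  simp only [e]
  exact hH.comp (measurable_pi_lambda _ fun s => hmeas s)

/-- The request at time `t` is independent of the list at time `t`, which depends on earlier
requests only; the integral is split according to its value. -/
theorem lintegral_listPos_succ {π : ℕ+ → ℝ≥0} (hmeas : ∀ t, Measurable (R t))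
    (hindep : iIndepFun R P) (hlaw : ∀ t k, P {ω | R t ω = k} = π k)
    (F : Equiv.Perm ℕ+ → ℝ≥0∞) (t : ℕ) :
    ∫⁻ ω, F (listPos (fun s => R s ω) (t + 1)) ∂P =
      ∫⁻ ω, ∑' r, π r * F (transposeStep (listPos (fun s => R s ω) t) r) ∂P := by
  have hI : ∀ r, Measurable fun ω => if R t ω = r then (1 : ℝ≥0∞) else 0 := fun r =>
    Measurable.ite (measurableSet_eq_fun (hmeas t) measurable_const) measurable_const
      measurable_const
  have hF : ∀ r, Measurable fun ω => F (transposeStep (listPos (fun s => R s ω) t) r) := fun r =>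
    measurable_listPos hmeas (fun σ => F (transposeStep σ r)) t
  have hIF : ∀ r, Measurable fun ω => (if R t ω = r then (1 : ℝ≥0∞) else 0) *
      F (transposeStep (listPos (fun s => R s ω) t) r) := fun r => (hI r).mul (hF r)
  have h1 : ∀ ω, F (listPos (fun s => R s ω) (t + 1)) =
      ∑' r, (if R t ω = r then 1 else 0) * F (transposeStep (listPos (fun s => R s ω) t) r) := by
    intro ω
    rw [tsum_eq_single (R t ω)]
    · rw [if_pos rfl, one_mul]; rfl
    · intro r hr
      rw [if_neg (Ne.symm hr), zero_mul]
  simp only [h1]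
  rw [lintegral_tsum fun r => (hIF r).aemeasurable,
    lintegral_tsum fun r => ((hF r).const_mul _).aemeasurable]
  refine tsum_congr fun r => ?_
  rw [lintegral_const_mul _ (hF r)]
  obtain ⟨H, hH, e⟩ := exists_listPos_factor (fun σ => F (transposeStep σ r)) t
  have hind : IndepFun (fun ω => if R t ω = r then (1 : ℝ≥0∞) else 0)
      (fun ω => F (transposeStep (listPos (fun s => R s ω) t) r)) P := by
    have h2 := hindep.indepFun_finset {t} (Finset.range t) (by simp) hmeas
    have h3 := h2.comp (φ := fun x : (({t} : Finset ℕ) → ℕ+) =>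
      if x ⟨t, Finset.mem_singleton_self t⟩ = r then (1 : ℝ≥0∞) else 0)
      (ψ := H) (measurable_of_countable _) hH
    simp only [e]
    exact h3
  have h4 := lintegral_mul_eq_lintegral_mul_lintegral_of_indepFun (hI r) (hF r) hind
  simp only [Pi.mul_apply] at h4
  rw [h4]
  congr 1
  rw [← hlaw t r, ← lintegral_indicator_one (measurableSet_eq_fun (hmeas t) measurable_const)]
  refine lintegral_congr fun ω => ?_
  simp [Set.indicator_apply]

theorem lintegral_listPos [IsProbabilityMeasure P] {π : ℕ+ → ℝ≥0} (hsum : HasSum π 1)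
    (hmeas : ∀ t, Measurable (R t)) (hindep : iIndepFun R P)
    (hlaw : ∀ t k, P {ω | R t ω = k} = π k) {u : Equiv.Perm ℕ+ → ℝ}
    (hu : ∀ σ, u σ ∈ Set.Icc (0 : ℝ) 1) (t : ℕ) :
    ∫⁻ ω, ENNReal.ofReal (u (listPos (fun s => R s ω) t)) ∂P =
      ENNReal.ofReal ((requestStep π)^[t] u (Equiv.refl ℕ+)) := by
  induction t generalizing u with
  | zero => simp [listPos]
  | succ t ih =>
    rw [lintegral_listPos_succ hmeas hindep hlaw (fun σ => ENNReal.ofReal (u σ)),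
      Function.iterate_succ_apply, ← ih (requestStep_mem_Icc hsum hu)]
    refine lintegral_congr fun ω => ?_
    rw [requestStep, ENNReal.ofReal_tsum_of_nonneg
      (fun r => mul_nonneg (π r).coe_nonneg (hu _).1)
      ((StepBounded.of_mem_Icc hu).summable hsum _)]
    refine tsum_congr fun r => ?_
    rw [ENNReal.ofReal_mul (π r).coe_nonneg, ENNReal.ofReal_coe_nnreal]

end

/-! ### The last particle and the conclusion -/

theorem ParticleConfig.le_lastPos {n : ℕ+} (z : ParticleConfig n) (k : Fin n) :
    (z.1 k : ℕ) ≤ lastPos z := by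
  refine (PNat.coe_le_coe _ _).2 (z.2.monotone ?_)
  change (k : ℕ) ≤ n - 1
  have := k.2
  omega

theorem lt_sup_listPos_iff {i : ℕ+} {σ : Equiv.Perm ℕ+} {x : ℕ} :
    (x < (Finset.Icc 1 i).sup fun j => (σ j : ℕ)) ↔ x < lastPos (itemConfig i σ) := by
  rw [Finset.lt_sup_iff]
  constructor
  · rintro ⟨j, hj, h⟩
    obtain ⟨k, hk⟩ := (apply_mem_range_itemConfig (i := i) (σ := σ)).2 (Finset.mem_Icc.1 hj).2
    rw [← hk] at h
    exact h.trans_le (le_lastPos _ k)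
  · intro h
    have h1 : (itemConfig i σ).1 ⟨i - 1, Nat.sub_lt i.pos one_pos⟩ ∈
      Set.range (itemConfig i σ).1 := ⟨_, rfl⟩
    rw [range_itemConfig] at h1
    obtain ⟨j, hj, e⟩ := h1
    refine ⟨j, Finset.mem_Icc.2 hj, ?_⟩
    rw [e]
    exact h

theorem lastPos_mono {n : ℕ+} : Monotone (lastPos (n := n)) := fun _ _ h =>
  (PNat.coe_le_coe _ _).2 (h _)

/-- Ensures that the truncated subtraction in the deviation law is a true one. -/
theorem self_le_lastPos {n : ℕ+} (z : ParticleConfig n) : (n : ℕ) ≤ lastPos z := by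
  have h := lastPos_mono (packed_le z)
  have h1 : lastPos (packed n) = n := Nat.sub_add_cancel n.pos
  omega

theorem proposition1
    {Ω : Type*} [MeasurableSpace Ω] (P : Measure Ω) [IsProbabilityMeasure P]
    (π : ℕ+ → ℝ≥0) (hsum : HasSum π 1) (hmono : Antitone π)
    (R : ℕ → Ω → ℕ+) (hmeas : ∀ t, Measurable (R t)) (hindep : iIndepFun R P)
    (hlaw : ∀ t k, P {ω | R t ω = k} = π k)
    (i : ℕ+) (hi : 0 < π i) :
    (π (i + 1) < π i →
      ∃ μ : PMF (ParticleConfig i), IsStationaryLaw i (π (i + 1) / π i) μ) ∧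
    ∀ κ : PMF ℕ∞, IsDeviationLaw i (π (i + 1) / π i) κ →
      ∀ x : ℕ, (i : ℕ) ≤ x →
        limsup (fun t : ℕ =>
          P {ω | x < (Finset.Icc 1 i).sup fun j => (listPos (fun s => R s ω) t j : ℕ)}) atTop
        ≤ κ.toMeasure {k : ℕ∞ | (x : ℕ∞) < k + ((i : ℕ) : ℕ∞)} := by
  refine ⟨fun h => exists_stationaryLaw ((div_lt_one hi).2 h), fun κ hκ x _ => ?_⟩
  set S : Set ℕ∞ := {k : ℕ∞ | (x : ℕ∞) < k + ((i : ℕ) : ℕ∞)} with hS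
  have hSm : MeasurableSet S := (Set.to_countable S).measurableSet
  rcases hκ with ⟨μ, hμ, rfl⟩ | ⟨-, rfl⟩
  swap
  · have h1 : (⊤ : ℕ∞) ∈ S := by
      rw [hS, Set.mem_ofPred_eq, top_add]
      exact ENat.natCast_lt_top x
    rw [PMF.toMeasure_pure, Measure.dirac_apply_of_mem h1]
    exact limsup_le_of_le (h := Eventually.of_forall fun t => prob_le_one)
  have hlt : π (i + 1) < π i := by
    refine lt_of_le_of_ne (hmono (PNat.lt_add_right i 1).le) fun h => ?_
    rw [h, div_self hi.ne'] at hμ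
    exact not_exists_stationaryLaw_one ⟨μ, hμ⟩
  set g : ParticleConfig i → ℝ := fun z => if x < lastPos z then 1 else 0 with hg
  have hgm : Monotone g := by
    intro z w h
    have := lastPos_mono h
    simp only [hg]
    split_ifs <;> first | omega | norm_num
  have hg01 : ∀ z, g z ∈ Set.Icc (0 : ℝ) 1 := by
    intro z
    simp only [hg]
    split_ifs <;> simp
  set C : ℝ≥0∞ := ∑' z, μ z * ENNReal.ofReal (g z) with hC
  have hCS : C = (μ.map fun z => ((lastPos z - i : ℕ) : ℕ∞)).toMeasure S := by
    let _ : MeasurableSpace (ParticleConfig i) := ⊤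
    rw [PMF.toMeasure_map_apply _ _ _ measurable_from_top hSm,
      PMF.toMeasure_apply _ MeasurableSpace.measurableSet_top, hC]
    refine tsum_congr fun z => ?_
    have h1 : z ∈ (fun z : ParticleConfig i => ((lastPos z - i : ℕ) : ℕ∞)) ⁻¹' S ↔
        x < lastPos z := by
      rw [Set.mem_preimage, hS, Set.mem_ofPred_eq, ← Nat.cast_add,
        Nat.sub_add_cancel (self_le_lastPos z), Nat.cast_lt]
    by_cases h : x < lastPos z
    · rw [Set.indicator_of_mem (h1.2 h)]
      simp [hg, h]
    · rw [Set.indicator_of_notMem (mt h1.1 h)]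
      simp [hg, h]
  have hC1 : C ≤ 1 := by rw [hCS]; exact prob_le_one
  have hCtop : C ≠ ⊤ := ne_top_of_le_ne_top ENNReal.one_ne_top hC1
  rw [← hCS]
  set β : ℝ≥0 := π (i + 1) / π i with hβ
  -- The time change between the normalized jump rates and the request probabilities `π i`, `π (i +
  -- 1)`.
  set s : ℝ := (π i : ℝ) + π (i + 1) with hs
  have hπi : (0 : ℝ) < π i := hi
  have hs0 : 0 < s := by have := (π (i + 1)).coe_nonneg; rw [hs]; linarith
  have hp' : s * ((1 / (1 + β) : ℝ≥0) : ℝ) = π i := by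
    rw [hβ, hs]; push_cast; field_simp
  have hq' : s * ((β / (1 + β) : ℝ≥0) : ℝ) = π (i + 1) := by
    rw [hβ, hs]; push_cast; field_simp
  set δ : ℝ := min 1 (1 / (i * s)) with hδ
  have hi0 : (0 : ℝ) < i := Nat.cast_pos.2 i.pos
  have hδ0 : 0 < δ := lt_min one_pos (by positivity)
  have hδ1 : δ ≤ 1 := min_le_left _ _
  have hδs : δ * (i * s) ≤ 1 := by
    rw [← le_div_iff₀ (by positivity)]; exact min_le_right _ _
  have hc : ∀ j, (lazyStep δ (π i) (π (i + 1)))^[j] g (packed i) ≤ C.toReal := by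
    intro j
    have h1 := iterate_lazyStep_packed_le hμ hs0.le hδ0.le (by rw [hp', hq']; exact hδs) hgm
      (fun z => (hg01 z).1) j
    rw [hp', hq'] at h1
    exact (ENNReal.ofReal_le_iff_le_toReal hCtop).1 h1
  obtain ⟨ρ, M, hρ0, hρ1, hbound⟩ := exists_iterate_requestStep_le hsum hmono hlt hδ0 hδ1 hδs hgm
    hg01 hc (Equiv.refl ℕ+)
  have hprob : ∀ t, P {ω | x < (Finset.Icc 1 i).sup fun j => (listPos (fun s => R s ω) t j : ℕ)} ≤
      ENNReal.ofReal (C.toReal + M * ρ ^ t) := by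
    intro t
    refine le_trans (le_of_eq ?_) (ENNReal.ofReal_le_ofReal (hbound t))
    rw [← lintegral_listPos hsum hmeas hindep hlaw (fun σ => hg01 (itemConfig i σ)) t]
    have hset : MeasurableSet
        {ω | x < (Finset.Icc 1 i).sup fun j => (listPos (fun s => R s ω) t j : ℕ)} := by
      have h1 := measurable_listPos hmeas
        (fun σ => ENNReal.ofReal (g (itemConfig i σ))) t (measurableSet_singleton 1)
      convert h1 using 1
      ext ω
      simp only [Set.mem_ofPred_eq, Set.mem_preimage, Set.mem_singleton_iff, hg]
      rw [lt_sup_listPos_iff]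
      split_ifs with h <;> simp [h]
    rw [← lintegral_indicator_one hset]
    refine lintegral_congr fun ω => ?_
    simp only [Set.indicator_apply, Set.mem_ofPred_eq, hg, lt_sup_listPos_iff]
    split_ifs <;> simp
  have hlim : Tendsto (fun t => ENNReal.ofReal (C.toReal + M * ρ ^ t)) atTop (nhds C) := by
    have h1 := ((tendsto_pow_atTop_nhds_zero_of_lt_one hρ0 hρ1).const_mul M).const_add C.toReal
    have h2 := ENNReal.tendsto_ofReal h1
    rwa [mul_zero, add_zero, ENNReal.ofReal_toReal hCtop] at h2
  rw [← hlim.limsup_eq]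
  exact limsup_le_limsup (Eventually.of_forall hprob)
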